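/- Let $k\ge 1$ be an integer and $c_M>0$. There exist constants $c_L, C>0$, depending only on $k$ and $c_M$, such that the following holds. Let $\Omega\subset\mathbb R^3$ be an open convex polyhedron (bounded and non-empty) and let $\Omega_h$ be a conforming decomposition of $\Omega$ into finitely many closed non-degenerate tetrahedra $E$, with $h_E$ the diameter of $E$, which is shape regular with constant $c_M$: each $E\in\Omega_h$ is star shaped with respect to a ball of radius $\rho_E>0$ with $h_E\le c_M\rho_E$. Write $\|\cdot\|_E$ and $\|\cdot\|$ for the norms of $L^2(E)$ and $L^2(\Omega)$. Let $\mathbb P_k^{\rm cont}(\Omega_h)$ be the space of functions that are continuous on $\overline\Omega$ and whose restriction to each $E\in\Omega_h$ is a polynomial of degree at most $k$. For $S\subseteq\Omega_h$ let $\|w\|_{W^1_\infty(S)}=\max_{E\in S}\|w\|_{W^1_\infty(E)}$, where $\|w\|_{W^1_\infty(E)}=\max\{\|w\|_{L^\infty(E)},\|\nabla w\|_{L^\infty(E)}\}$, and let $W^1_\infty(\Omega_h)$ be the space of those $w\in L^2(\Omega)$ with $w|_E\in W^1_\infty(E)$ for all $E\in\Omega_h$. For a function $w$ on $\Omega$ (up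 to almost everywhere equality) that has a representative continuous on $\overline\Omega$, the Lagrange interpolant $\mathcal I_L w$ is the element of $\mathbb P_k^{\rm cont}(\Omega_h)$ that agrees with this representative at all points of the principal lattice of order $k$ of each $E\in\Omega_h$, that is, at the points of $E$ with barycentric coordinates in $\{0,1/k,\dots,1\}$. Let $\varepsilon>0$ and $u\in H^{3/2+\varepsilon}(\Omega)\cap W^1_\infty(\Omega_h)$. Then $u$ has a representative that is continuous on $\overline\Omega$, $\mathcal I_L u$ exists and is unique, and: (i) for every $S\subseteq\Omega_h$, $$\|\mathcal I_L u\|_{L^\infty(\cup_{E\in S}E)}\le c_L\|u\|_{L^\infty(\cup_{E\in S}E)},\qquad \|\mathcal I_L u\|_{W^1_\infty(S)}\le c_L\|u\|_{W^1_\infty(S)},$$ and for every $E\in\Omega_h$, $$\|u-\mathcal I_L u\|_{L^\infty(E)}+h_E\|\nabla(u-\mathcal I_L u)\|_{L^\infty(E)}\le C\,h_E\,\|u\|_{W^1_\infty(E)};$$ (ii) for every $v_h\in\mathbb P_k^{\rm cont}(\Omega_h)$, the interpolant $\mathcal I_L(uv_h)$ exists and is unique, and $$\sum_{E\in\Omega_h}h_E^{-2}\|uv_h-\mathcal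 I_L(uv_h)\|_E^2\le C\,\|u\|_{W^1_\infty(\Omega_h)}^2\|v_h\|^2,$$ $$\sum_{E\in\Omega_h}h_E^{-2}\|\mathcal I_L(uv_h)-(\mathcal I_L u)v_h\|_E^2\le C\,\|u\|_{W^1_\infty(\Omega_h)}^2\|v_h\|^2.$$ -/

import Mathlib

open MeasureTheory Set
open scoped ENNReal

noncomputable section

/-- Three-dimensional Euclidean space. -/
abbrev R3 : Type := EuclideanSpace ℝ (Fin 3)

/-! ### Weak derivatives and Sobolev spaces -/

/-- `g` is the weak derivative `∂_{ι 0} ⋯ ∂_{ι (n-1)} u` of order `n` on the open set `U`. -/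
def HasWeakDeriv (U : Set R3) {n : ℕ} (ι : Fin n → Fin 3) (u g : R3 → ℝ) : Prop :=
  LocallyIntegrableOn u U volume ∧ LocallyIntegrableOn g U volume ∧
    ∀ φ : R3 → ℝ, ContDiff ℝ (⊤ : ℕ∞) φ → HasCompactSupport φ → tsupport φ ⊆ U →
      ∫ x in U, u x * iteratedFDeriv ℝ n φ x (fun j => EuclideanSpace.single (ι j) (1 : ℝ)) =
        (-1 : ℝ) ^ n * ∫ x in U, g x * φ x

/-- `G` is the weak gradient of `u` on the open set `U`. -/
def HasWeakGrad (U : Set R3) (u : R3 → ℝ) (G : R3 → R3) : Prop :=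
  ∀ i : Fin 3, HasWeakDeriv U (fun _ : Fin 1 => i) u (fun x => G x i)

/-- The square of the Gagliardo seminorm of order `σ ∈ (0,1)` on `U`:
`∫_U ∫_U |g x - g y|² / |x - y|^(3 + 2σ)`. -/
def gagliardoSq (U : Set R3) (σ : ℝ) (g : R3 → ℝ) : ℝ≥0∞ :=
  ∫⁻ x in U, ∫⁻ y in U, ENNReal.ofReal ((g x - g y) ^ 2 / ‖x - y‖ ^ (3 + 2 * σ))

/-- Membership in the (Sobolev–Slobodeckij) space `H^s(U)`, for real `s ≥ 0` and `U` open: with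
`m = ⌊s⌋`, all weak derivatives of order at most `m` are in `L²(U)` and, if `s` is not an integer,
those of order `m` have finite Gagliardo seminorm of order `s - m`. -/
def MemHs (s : ℝ) (U : Set R3) (u : R3 → ℝ) : Prop :=
  ∀ n : ℕ, n ≤ ⌊s⌋₊ → ∀ ι : Fin n → Fin 3, ∃ g : R3 → ℝ,
    HasWeakDeriv U ι u g ∧ MemLp g 2 (volume.restrict U) ∧
      (n = ⌊s⌋₊ → 0 < s - ⌊s⌋₊ → gagliardoSq U (s - ⌊s⌋₊) g < ∞)

/-- `‖∇u‖_{L^∞(U)}` for the weak gradient of `u` on the open set `U`. The weak gradient is unique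
almost everywhere; the value is `∞` if there is none. -/
def gradLinfNorm (U : Set R3) (u : R3 → ℝ) : ℝ≥0∞ :=
  ⨅ (G : R3 → R3) (_ : HasWeakGrad U u G), eLpNorm G ∞ (volume.restrict U)

/-- The norm of `W^1_∞(U)`: the larger one of `‖u‖_{L^∞(U)}` and `‖∇u‖_{L^∞(U)}`. -/
def w1infNorm (U : Set R3) (u : R3 → ℝ) : ℝ≥0∞ :=
  max (eLpNorm u ∞ (volume.restrict U)) (gradLinfNorm U u)

/-- Membership in `W^1_∞(U)`. -/
def MemW1inf (U : Set R3) (u : R3 → ℝ) : Prop :=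
  AEStronglyMeasurable u (volume.restrict U) ∧ w1infNorm U u < ∞

/-! ### Meshes -/

/-- An (open) convex polyhedron in `ℝ³`. -/
def IsConvexPolyhedron (Ω : Set R3) : Prop :=
  Ω.Nonempty ∧ ∃ F : Finset R3, Ω = interior (convexHull ℝ (F : Set R3))

/-- The closed simplex with vertex set `s`. -/
def simplexHull (s : Finset R3) : Set R3 := convexHull ℝ (s : Set R3)

/-- The diameter `h_E` of the closed simplex `E` with vertex set `s`. -/
def simplexDiam (s : Finset R3) : ℝ := Metric.diam (simplexHull s)

/-- A conforming decomposition of `Ω` into (finitely many, nondegenerate, closed) tetrahedra, each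
given by its set of four vertices: any two of them meet in the convex hull of their common
vertices. -/
structure TetMesh (Ω : Set R3) where
  elements : Finset (Finset R3)
  card_eq : ∀ s ∈ elements, s.card = 4
  indep : ∀ s ∈ elements, AffineIndependent ℝ ((↑) : s → R3)
  conforming : ∀ s ∈ elements, ∀ t ∈ elements,
    simplexHull s ∩ simplexHull t = convexHull ℝ ((s : Set R3) ∩ (t : Set R3))
  cover : (⋃ s ∈ elements, simplexHull s) = closure Ω

/-- The points of the principal lattice of order `k` of the simplex with vertex set `s`, that is, the
points with barycentric coordinates in `{0, 1/k, …, 1}`: the Lagrange nodes for degree `k`. -/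
def lagrangeNodes (k : ℕ) (s : Finset R3) : Set R3 :=
  {x | ∃ α : R3 → ℕ, ∑ v ∈ s, α v = k ∧ x = ∑ v ∈ s, ((α v : ℝ) / (k : ℝ)) • v}

/-- On the set `A`, `v` is a polynomial of degree at most `k`. -/
def IsPolyOn (k : ℕ) (A : Set R3) (v : R3 → ℝ) : Prop :=
  ∃ p : MvPolynomial (Fin 3) ℝ, p.totalDegree ≤ k ∧
    ∀ x ∈ A, v x = MvPolynomial.eval (fun i => x i) p

namespace TetMesh

variable {Ω : Set R3} (T : TetMesh Ω)

/-- Shape regularity with constant `cM`: each element `E` is star shaped with respect to a ball of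
radius `ρ_E` with `h_E ≤ cM * ρ_E`. -/
def ShapeRegular (cM : ℝ) : Prop :=
  ∀ s ∈ T.elements, ∃ (x₀ : R3) (ρ : ℝ), 0 < ρ ∧ simplexDiam s ≤ cM * ρ ∧
    Metric.ball x₀ ρ ⊆ simplexHull s ∧
    ∀ y ∈ Metric.ball x₀ ρ, StarConvex ℝ y (simplexHull s)

/-- The broken norm of `W^1_∞(S)` for a set `S` of elements: the maximum over `E ∈ S` of the norms of
`W^1_∞(E)`. -/
def brokenW1infNorm (S : Finset (Finset R3)) (u : R3 → ℝ) : ℝ≥0∞ :=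
  S.sup fun s => w1infNorm (interior (simplexHull s)) u

/-- Membership in the broken space `W^1_∞(Ω_h)`. -/
def MemBrokenW1inf (u : R3 → ℝ) : Prop :=
  MemLp u 2 (volume.restrict Ω) ∧ ∀ s ∈ T.elements, MemW1inf (interior (simplexHull s)) u

/-- Membership in the space of continuous functions on the closed domain that are polynomials of
degree at most `k` on each element. Values outside the closed domain are irrelevant. -/
def MemPkCont (k : ℕ) (v : R3 → ℝ) : Prop :=
  ContinuousOn v (closure Ω) ∧ ∀ s ∈ T.elements, IsPolyOn k (simplexHull s) v

/-- `w` is the Lagrange interpolant of degree `k` of (the class of) `u`: a continuous piecewise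
polynomial that takes, at all the Lagrange nodes, the values of the representative of `u` that is
continuous on the closed domain. -/
def IsLagrangeInterpolant (k : ℕ) (u w : R3 → ℝ) : Prop :=
  T.MemPkCont k w ∧ ∃ g : R3 → ℝ, ContinuousOn g (closure Ω) ∧ g =ᵐ[volume.restrict Ω] u ∧
    ∀ s ∈ T.elements, ∀ x ∈ lagrangeNodes k s, w x = g x

open Classical in
/-- The Lagrange interpolation operator (with value `0` where there is no interpolant). -/
def lagrangeInterp (k : ℕ) (u : R3 → ℝ) : R3 → ℝ :=
  if h : ∃ w, T.IsLagrangeInterpolant k u w then Classical.choose h else 0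

/-- `u` has a Lagrange interpolant, it is unique on the closed domain, and `lagrangeInterp` is it. -/
def InterpWellDefined (k : ℕ) (u : R3 → ℝ) : Prop :=
  T.IsLagrangeInterpolant k u (T.lagrangeInterp k u) ∧
    ∀ w, T.IsLagrangeInterpolant k u w → EqOn w (T.lagrangeInterp k u) (closure Ω)

/-- `∑_{E ∈ Ω_h} h_E^(-2) ‖f‖²_{L²(E)}`. -/
def weightedL2Sq (f : R3 → ℝ) : ℝ≥0∞ :=
  ∑ s ∈ T.elements, ENNReal.ofReal ((simplexDiam s)⁻¹ ^ 2) *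
    eLpNorm f 2 (volume.restrict (simplexHull s)) ^ 2

end TetMesh

end

/-! Membership in `H^(3/2+ε)` supplies one weak gradient on all of `Ω`. On each element it agrees
almost everywhere with the broken gradient, so it is bounded, and on a convex open set mollification
turns a bounded weak gradient into a Lipschitz representative `g`
(`HasWeakGrad.exists_lipschitzWith`). Hence `g` is continuous up to the boundary, and on an element
`E` its Lipschitz constant is at most `L = ‖∇u‖_{L^∞(E)}`.

On `E` the interpolant is an explicit sum of nodal values times products in the barycentric
coordinates (`localInterp`). On a common face these expressions coincide for both neighbours, so the
pieces glue continuously. A dimension count gives unisolvence (`eq_zero_of_eval_latticeNode`), hence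
uniqueness and reproduction of polynomials. The basis functions are bounded in terms of `k` alone,
which gives a Lebesgue constant `Λ`; barycentric coordinates have Lipschitz constant at most `1/ρ`,
which together with `h ≤ cM ρ` gives stability of the gradient.

For the product estimates, freeze the coefficient at `x`: the polynomial `g(x) v` is reproduced, so
the error at `x` is, up to sign, the interpolant of `(g - g(x)) v` at `x`, at most `Λ L h max |v|`
(`abs_mul_sub_localInterp_le`). No derivative of `v` enters. The bound `|E| max |v|² ≤ c_k ‖v‖_E²`
(`IsPolyOn.sq_mul_volume_le`) converts this to `L²`, the factor `h` cancels the weight, and the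
elements are summed using disjointness of their interiors. -/

open Filter (Eventually Tendsto atTop)

noncomputable section

/-! ### Barycentric coordinates -/

/-- `s` is the vertex set of a nondegenerate tetrahedron. -/
def IsTet (s : Finset R3) : Prop :=
  s.card = 4 ∧ AffineIndependent ℝ ((↑) : s → R3)

theorem IsTet.affineSpan_eq_top {s : Finset R3} (h : IsTet s) :
    affineSpan ℝ (range ((↑) : s → R3)) = ⊤ := by
  rw [h.2.affineSpan_eq_top_iff_card_eq_finrank_add_one]
  simp [h.1]

/-- The affine basis formed by the vertices of a tetrahedron. -/
def IsTet.basis {s : Finset R3} (h : IsTet s) : AffineBasis s ℝ R3 :=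
  ⟨((↑) : s → R3), h.2, h.affineSpan_eq_top⟩

theorem IsTet.basis_apply {s : Finset R3} (h : IsTet s) (v : s) : h.basis v = v := rfl

open Classical in
/-- The barycentric coordinate at the vertex `v` of the tetrahedron with vertex set `s`. -/
def bary (s : Finset R3) (v : R3) : R3 →ᵃ[ℝ] ℝ :=
  -- The default `0` is still an affine map, so the polynomial and smoothness statements below hold
  -- for every finite set `s`.
  if h : ∃ _ : IsTet s, v ∈ s then h.1.basis.coord ⟨v, h.2⟩ else 0

theorem bary_eq_coord {s : Finset R3} (h : IsTet s) (v : s) :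
    bary s v = h.basis.coord v := by
  have : ∃ _ : IsTet s, (v : R3) ∈ s := ⟨h, v.2⟩
  rw [bary, dif_pos this]

theorem sum_bary {s : Finset R3} (h : IsTet s) (x : R3) : ∑ v ∈ s, bary s v x = 1 := by
  rw [← Finset.sum_coe_sort, ← h.basis.sum_coord_apply_eq_one x]
  exact Finset.sum_congr rfl fun v _ => by rw [bary_eq_coord h]

theorem bary_sum_smul {s : Finset R3} (h : IsTet s) {w : R3 → ℝ} (hw : ∑ v ∈ s, w v = 1)
    {v : R3} (hv : v ∈ s) : bary s v (∑ v ∈ s, w v • v) = w v := by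
  have hw' : ∑ i : s, w i = 1 := by rw [Finset.sum_coe_sort]; exact hw
  have := h.basis.coord_apply_combination_of_mem (Finset.mem_univ (⟨v, hv⟩ : s))
    (w := fun i => w i) hw'
  rw [Finset.affineCombination_eq_linear_combination _ _ _ hw'] at this
  rw [← bary_eq_coord h] at this
  rw [← this, ← Finset.sum_coe_sort]
  rfl

theorem mem_simplexHull_iff {s : Finset R3} (h : IsTet s) {x : R3} :
    x ∈ simplexHull s ↔ ∀ v ∈ s, 0 ≤ bary s v x := by
  have h1 : simplexHull s = convexHull ℝ (range h.basis) := by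
    rw [simplexHull]; congr 1; ext y; simp [IsTet.basis_apply]
  rw [h1, h.basis.convexHull_eq_nonneg_coord]
  simp only [mem_ofPred_eq, Subtype.forall]
  refine forall₂_congr fun v hv => ?_
  rw [← bary_eq_coord h]

theorem bary_le_one {s : Finset R3} (h : IsTet s) {x : R3} (hx : x ∈ simplexHull s)
    {v : R3} (hv : v ∈ s) : bary s v x ≤ 1 := by
  rw [← sum_bary h x]
  exact Finset.single_le_sum (f := fun v => bary s v x)
    (fun w hw => (mem_simplexHull_iff h).1 hx w hw) hv

theorem subset_simplexHull {s : Finset R3} {v : R3} (hv : v ∈ s) : v ∈ simplexHull s :=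
  subset_convexHull ℝ _ hv

open Classical in
-- Weights on the shared vertices, extended by zero, represent `x` in both simplices; uniqueness of
-- barycentric coordinates identifies them with the coordinates of each.
theorem exists_weights_of_mem_convexHull_inter {s t : Finset R3} (hs : IsTet s) (ht : IsTet t)
    {x : R3} (hx : x ∈ convexHull ℝ ((s : Set R3) ∩ (t : Set R3))) :
    ∃ w : R3 → ℝ, (∀ v ∈ s, bary s v x = w v) ∧ (∀ v ∈ t, bary t v x = w v) ∧
      ∀ v, v ∉ s ∩ t → w v = 0 := by
  rw [← Finset.coe_inter, Finset.mem_convexHull'] at hx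
  obtain ⟨w, -, hw1, hwx⟩ := hx
  have key : ∀ r : Finset R3, s ∩ t ⊆ r → IsTet r → ∀ v ∈ r,
      bary r v x = if v ∈ s ∩ t then w v else 0 := by
    intro r hr hr' v hv
    have e1 : ∑ v ∈ r, (if v ∈ s ∩ t then w v else 0) = 1 := by
      rw [← hw1, ← Finset.sum_subset hr]
      · exact Finset.sum_congr rfl fun i hi => if_pos hi
      · intro i _ hi; exact if_neg hi
    have e2 : ∑ v ∈ r, (if v ∈ s ∩ t then w v else 0) • v = x := by
      rw [← hwx, ← Finset.sum_subset hr]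
      · exact Finset.sum_congr rfl fun i hi => by rw [if_pos hi]
      · intro i _ hi; rw [if_neg hi, zero_smul]
    conv_lhs => rw [← e2]
    exact bary_sum_smul hr' (w := fun v => if v ∈ s ∩ t then w v else 0) e1 hv
  exact ⟨fun v => if v ∈ s ∩ t then w v else 0, key s Finset.inter_subset_left hs,
    key t Finset.inter_subset_right ht, fun v hv => if_neg hv⟩

/-! ### The Lagrange basis, gluing across faces and unisolvence -/

/-- The node of the principal lattice with barycentric coordinates `α / k`. -/
def latticeNode (k : ℕ) (s : Finset R3) (α : R3 → ℕ) : R3 :=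
  ∑ v ∈ s, ((α v : ℝ) / (k : ℝ)) • v

/-- The nodal basis function of degree `k` at the lattice node with index `α`, as a function of the
barycentric coordinates `w`. -/
def lagrangeShape (k : ℕ) (s : Finset R3) (α : R3 → ℕ) (w : R3 → ℝ) : ℝ :=
  -- The inner product is the generalised binomial coefficient of `k * w v` over `α v`. It is a
  -- polynomial of degree `α v` in `w v`, so the total degree is `∑ α v`.
  ∏ v ∈ s, ∏ j ∈ Finset.range (α v), ((k : ℝ) * w v - j) / (j + 1)

open Classical in
/-- The Lagrange interpolant of degree `k` of `g` on the tetrahedron with vertex set `s`. -/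
def localInterp (k : ℕ) (s : Finset R3) (g : R3 → ℝ) (x : R3) : ℝ :=
  ∑ α ∈ s.piAntidiag k, g (latticeNode k s α) * lagrangeShape k s α (fun v => bary s v x)

theorem sum_div_eq_one {k : ℕ} (hk : 1 ≤ k) {s : Finset R3} {α : R3 → ℕ}
    (hα : ∑ v ∈ s, α v = k) : ∑ v ∈ s, (α v : ℝ) / (k : ℝ) = 1 := by
  rw [← Finset.sum_div, ← Nat.cast_sum, hα]
  exact div_self (by positivity)

theorem bary_latticeNode {k : ℕ} (hk : 1 ≤ k) {s : Finset R3} (h : IsTet s) {α : R3 → ℕ}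
    (hα : ∑ v ∈ s, α v = k) {v : R3} (hv : v ∈ s) :
    bary s v (latticeNode k s α) = (α v : ℝ) / k :=
  bary_sum_smul h (w := fun v => (α v : ℝ) / k) (sum_div_eq_one hk hα) hv

theorem latticeNode_mem {k : ℕ} (hk : 1 ≤ k) {s : Finset R3} (h : IsTet s) {α : R3 → ℕ}
    (hα : ∑ v ∈ s, α v = k) : latticeNode k s α ∈ simplexHull s := by
  rw [mem_simplexHull_iff h]
  intro v hv
  rw [bary_latticeNode hk h hα hv]
  positivity

open Classical in
theorem mem_lagrangeNodes_iff {k : ℕ} {s : Finset R3} {x : R3} :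
    x ∈ lagrangeNodes k s ↔ ∃ α ∈ s.piAntidiag k, x = latticeNode k s α := by
  constructor
  · rintro ⟨α, hα, rfl⟩
    refine ⟨fun v => if v ∈ s then α v else 0, ?_, ?_⟩
    · rw [Finset.mem_piAntidiag]
      refine ⟨?_, ?_⟩
      · rw [← hα]
        exact Finset.sum_congr rfl fun v hv => if_pos hv
      · intro i hi
        by_contra hc
        simp [hc] at hi
    · exact Finset.sum_congr rfl fun v hv => by simp only [if_pos hv]
  · rintro ⟨α, hα, rfl⟩
    exact ⟨α, (Finset.mem_piAntidiag.1 hα).1, rfl⟩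

theorem prod_range_sub_div (b a : ℕ) :
    ∏ j ∈ Finset.range a, ((b : ℝ) - j) / (j + 1) = (b.choose a : ℝ) := by
  induction a with
  | zero => simp
  | succ a ih =>
    rw [Finset.prod_range_succ, ih]
    have h1 : (a : ℝ) + 1 ≠ 0 := by positivity
    rw [mul_div_assoc', div_eq_iff h1]
    have := Nat.choose_succ_right_eq b a
    rcases le_or_gt a b with hab | hab
    · rw [← Nat.cast_sub hab]; exact_mod_cast this.symm
    · rw [Nat.choose_eq_zero_of_lt hab, Nat.choose_eq_zero_of_lt (by omega)]; simp

theorem lagrangeShape_eq_prod_choose {k : ℕ} (hk : 1 ≤ k) {s : Finset R3} (h : IsTet s)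
    {α β : R3 → ℕ} (hβ : ∑ v ∈ s, β v = k) :
    lagrangeShape k s α (fun v => bary s v (latticeNode k s β)) =
      ∏ v ∈ s, ((β v).choose (α v) : ℝ) := by
  refine Finset.prod_congr rfl fun v hv => ?_
  rw [← prod_range_sub_div]
  refine Finset.prod_congr rfl fun j _ => ?_
  have : (0 : ℝ) < k := by exact_mod_cast hk
  simp only [bary_latticeNode hk h hβ hv, mul_div_cancel₀ _ this.ne']

open Classical in
-- Two distinct indices with the same sum `k` satisfy `β v < α v` at some vertex, and there the
-- binomial coefficient vanishes.
theorem lagrangeShape_latticeNode {k : ℕ} (hk : 1 ≤ k) {s : Finset R3} (h : IsTet s)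
    {α β : R3 → ℕ} (hα : α ∈ s.piAntidiag k) (hβ : β ∈ s.piAntidiag k) :
    lagrangeShape k s α (fun v => bary s v (latticeNode k s β)) = if α = β then 1 else 0 := by
  rw [Finset.mem_piAntidiag] at hα hβ
  rw [lagrangeShape_eq_prod_choose hk h hβ.1]
  split_ifs with hab
  · subst hab; simp
  · by_cases hle : ∀ v ∈ s, α v ≤ β v
    · exfalso
      apply hab
      have := (Finset.sum_eq_sum_iff_of_le hle).1 (hα.1.trans hβ.1.symm)
      funext v
      by_cases hv : v ∈ s
      · exact this v hv
      · rw [not_imp_comm.1 (hα.2 v) hv, not_imp_comm.1 (hβ.2 v) hv]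
    · push Not at hle
      obtain ⟨v, hv, hlt⟩ := hle
      exact Finset.prod_eq_zero hv (by rw [Nat.choose_eq_zero_of_lt hlt, Nat.cast_zero])

open Classical in
theorem localInterp_latticeNode {k : ℕ} (hk : 1 ≤ k) {s : Finset R3} (h : IsTet s) (g : R3 → ℝ)
    {β : R3 → ℕ} (hβ : β ∈ s.piAntidiag k) :
    localInterp k s g (latticeNode k s β) = g (latticeNode k s β) := by
  rw [localInterp, Finset.sum_eq_single β]
  · rw [lagrangeShape_latticeNode hk h hβ hβ]; simp
  · intro α hα hne
    rw [lagrangeShape_latticeNode hk h hα hβ, if_neg hne, mul_zero]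
  · exact fun hn => (hn hβ).elim

open Classical in
-- A basis function whose index charges a vertex off the common face contains the factor `j = 0`,
-- which is `k * w v = 0`. The remaining terms involve only nodes and coordinates of the face, so
-- both sides equal the same sum over the face.
theorem localInterp_eq_of_face {k : ℕ} {s t : Finset R3} (hs : IsTet s)
    (ht : IsTet t) (g : R3 → ℝ) {x : R3}
    (hx : x ∈ convexHull ℝ ((s : Set R3) ∩ (t : Set R3))) :
    localInterp k s g x = localInterp k t g x := by
  obtain ⟨w, hws, hwt, hw0⟩ := exists_weights_of_mem_convexHull_inter hs ht hx
  have key : ∀ r : Finset R3, s ∩ t ⊆ r → (∀ v ∈ r, bary r v x = w v) →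
      localInterp k r g x = ∑ α ∈ (s ∩ t).piAntidiag k,
        g (latticeNode k (s ∩ t) α) * lagrangeShape k (s ∩ t) α w := by
    intro r hr hbw
    rw [localInterp]
    have e0 : ∀ α, lagrangeShape k r α (fun v => bary r v x) = lagrangeShape k r α w :=
      fun α => Finset.prod_congr rfl fun v hv => by simp only [hbw v hv]
    simp only [e0]
    have hsub : (s ∩ t).piAntidiag k ⊆ r.piAntidiag k := by
      intro α hα
      rw [Finset.mem_piAntidiag] at hα ⊢
      refine ⟨?_, fun i hi => hr (hα.2 i hi)⟩
      rw [← hα.1]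
      exact (Finset.sum_subset hr fun i _ hi => by_contra fun hne => hi (hα.2 i hne)).symm
    rw [← Finset.sum_subset hsub]
    · refine Finset.sum_congr rfl fun α hα => ?_
      rw [Finset.mem_piAntidiag] at hα
      have h0 : ∀ i ∈ r, i ∉ s ∩ t → α i = 0 := fun i _ hi => by_contra fun hne => hi (hα.2 i hne)
      congr 1
      · congr 1
        exact (Finset.sum_subset hr fun i hi hi' => by simp [h0 i hi hi']).symm
      · exact (Finset.prod_subset hr fun i hi hi' => by simp [h0 i hi hi']).symm
    · intro α hα hα'
      rw [Finset.mem_piAntidiag] at hα hα'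
      have : ∃ v, v ∈ r ∧ v ∉ s ∩ t ∧ α v ≠ 0 := by
        by_contra hc
        push Not at hc
        apply hα'
        have h0 : ∀ i, α i ≠ 0 → i ∈ s ∩ t := fun i hi =>
          by_contra fun hn => hi (hc i (hα.2 i hi) hn)
        refine ⟨?_, h0⟩
        rw [← hα.1]
        exact Finset.sum_subset hr fun i _ hi => by_contra fun hne => hi (h0 i hne)
      obtain ⟨v, hvr, hv, hαv⟩ := this
      have : lagrangeShape k r α w = 0 := by
        refine Finset.prod_eq_zero hvr
          (Finset.prod_eq_zero (Finset.mem_range.2 (Nat.pos_of_ne_zero hαv)) ?_)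
        simp [hw0 v hv]
      rw [this, mul_zero]
  rw [key s Finset.inter_subset_left hws, key t Finset.inter_subset_right hwt]

theorem exists_mvPolynomial_eq_affineMap (f : R3 →ᵃ[ℝ] ℝ) :
    ∃ q : MvPolynomial (Fin 3) ℝ, q.totalDegree ≤ 1 ∧
      ∀ x : R3, MvPolynomial.eval (fun i => x i) q = f x := by
  refine ⟨MvPolynomial.C (f 0) +
    ∑ i, MvPolynomial.C (f.linear (EuclideanSpace.single i 1)) * MvPolynomial.X i, ?_, ?_⟩
  · refine (MvPolynomial.totalDegree_add _ _).trans (max_le (by simp) ?_)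
    refine MvPolynomial.totalDegree_finsetSum_le fun i _ => ?_
    refine (MvPolynomial.totalDegree_mul _ _).trans (by simp)
  · intro x
    have h1 : f x = f.linear x + f 0 := congrFun f.decomp x
    have h2 : x = ∑ i, x i • EuclideanSpace.single i (1 : ℝ) := by
      ext j
      simp [Finset.sum_apply, Pi.single_apply]
    rw [h1]
    conv_rhs => rw [h2]
    simp only [map_add, map_sum, map_mul, MvPolynomial.eval_C, MvPolynomial.eval_X, map_smul,
      smul_eq_mul]
    rw [add_comm]
    congr 1
    exact Finset.sum_congr rfl fun i _ => mul_comm _ _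

theorem exists_mvPolynomial_eq_lagrangeShape (k : ℕ) (s : Finset R3) (α : R3 → ℕ) :
    ∃ q : MvPolynomial (Fin 3) ℝ, q.totalDegree ≤ ∑ v ∈ s, α v ∧
      ∀ x : R3, MvPolynomial.eval (fun i => x i) q =
        lagrangeShape k s α (fun v => bary s v x) := by
  choose q hq hqe using fun v => exists_mvPolynomial_eq_affineMap (bary s v)
  refine ⟨∏ v ∈ s, ∏ j ∈ Finset.range (α v),
    (MvPolynomial.C (k : ℝ) * q v - MvPolynomial.C (j : ℝ)) * MvPolynomial.C ((j + 1 : ℝ)⁻¹),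
    ?_, ?_⟩
  · refine (MvPolynomial.totalDegree_finsetProd _ _).trans (Finset.sum_le_sum fun v _ => ?_)
    refine (MvPolynomial.totalDegree_finsetProd _ _).trans ?_
    refine (Finset.sum_le_card_nsmul _ _ 1 fun j _ => ?_).trans (by simp)
    refine (MvPolynomial.totalDegree_mul _ _).trans ?_
    rw [MvPolynomial.totalDegree_C, add_zero]
    refine (MvPolynomial.totalDegree_sub _ _).trans (max_le ?_
      (by rw [MvPolynomial.totalDegree_C]; exact zero_le_one))
    refine (MvPolynomial.totalDegree_mul _ _).trans ?_
    rw [MvPolynomial.totalDegree_C, zero_add]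
    exact hq v
  · intro x
    simp only [map_prod, map_mul, map_sub, MvPolynomial.eval_C, hqe, lagrangeShape,
      div_eq_mul_inv]

theorem isPolyOn_localInterp (k : ℕ) (s : Finset R3) (g : R3 → ℝ) (A : Set R3) :
    IsPolyOn k A (localInterp k s g) := by
  classical
  choose q hq hqe using exists_mvPolynomial_eq_lagrangeShape k s
  refine ⟨∑ α ∈ s.piAntidiag k, MvPolynomial.C (g (latticeNode k s α)) * q α, ?_, ?_⟩
  · refine MvPolynomial.totalDegree_finsetSum_le fun α hα => ?_
    refine (MvPolynomial.totalDegree_mul _ _).trans ?_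
    rw [MvPolynomial.totalDegree_C, zero_add]
    exact (hq α).trans (Finset.mem_piAntidiag.1 hα).1.le
  · intro x _
    simp only [map_sum, map_mul, MvPolynomial.eval_C, hqe, localInterp]

open Classical in
-- Homogenisation: a monomial of degree at most `k` in three variables becomes an index of sum `k`
-- on four vertices, the missing degree going to the extra vertex.
theorem finrank_restrictTotalDegree_le {s : Finset R3} (h : IsTet s) (k : ℕ) :
    Module.finrank ℝ (MvPolynomial.restrictTotalDegree (Fin 3) ℝ k) ≤ (s.piAntidiag k).card := by
  have e : s ≃ Fin 4 := s.equivFinOfCardEq h.1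
  let F : {n : Fin 3 →₀ ℕ | (n.sum fun _ e => e) ≤ k} → s.piAntidiag k := fun n =>
    ⟨fun v => if hv : v ∈ s then
      Fin.cons (α := fun _ => ℕ) (k - ∑ i, (n : Fin 3 →₀ ℕ) i) (n : Fin 3 →₀ ℕ) (e ⟨v, hv⟩)
        else 0, by
      rw [Finset.mem_piAntidiag]
      refine ⟨?_, fun i hi => by by_contra hc; simp [hc] at hi⟩
      rw [← Finset.sum_coe_sort]
      simp only [Finset.coe_mem, dif_pos, Subtype.coe_eta]
      rw [e.sum_comp (Fin.cons (α := fun _ => ℕ) _ _), Fin.sum_univ_succ]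
      simp only [Fin.cons_zero, Fin.cons_succ]
      have := n.2
      rw [mem_ofPred_eq, Finsupp.sum_fintype _ _ (fun _ => rfl)] at this
      omega⟩
  have hF : Function.Injective F := by
    intro n m hnm
    ext i
    have := congrFun (congrArg Subtype.val hnm) (e.symm i.succ)
    simpa [F] using this
  have := Finite.of_injective F hF
  have := Fintype.ofFinite {n : Fin 3 →₀ ℕ | (n.sum fun _ e => e) ≤ k}
  rw [MvPolynomial.restrictTotalDegree,
    Module.finrank_eq_card_basis (MvPolynomial.basisRestrictSupport ℝ _)]
  exact (Fintype.card_le_of_injective F hF).trans (by simp)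

/-- The nodal basis makes evaluation at the nodes surjective, and the polynomial space has dimension
at most the number of nodes; evaluation is therefore injective. -/
theorem eq_zero_of_eval_latticeNode {k : ℕ} (hk : 1 ≤ k) {s : Finset R3} (h : IsTet s)
    {p : MvPolynomial (Fin 3) ℝ} (hp : p.totalDegree ≤ k)
    (h0 : ∀ x ∈ lagrangeNodes k s, MvPolynomial.eval (fun i => x i) p = 0) : p = 0 := by
  classical
  let V := MvPolynomial.restrictTotalDegree (Fin 3) ℝ k
  let ev : V →ₗ[ℝ] (s.piAntidiag k → ℝ) := LinearMap.pi fun α =>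
    (MvPolynomial.aeval (fun i => latticeNode k s α i)).toLinearMap ∘ₗ V.subtype
  have hev : ∀ (q : V) α, ev q α = MvPolynomial.eval (fun i => latticeNode k s α i) q.1 :=
    fun q α => by simp [ev, MvPolynomial.aeval_eq_eval]
  choose q hq hqe using exists_mvPolynomial_eq_lagrangeShape k s
  have hsurj : Function.Surjective ev := by
    intro c
    let b : s.piAntidiag k → V := fun α => ⟨q α, (MvPolynomial.mem_restrictTotalDegree _ _ _).2
      ((hq α).trans (Finset.mem_piAntidiag.1 α.2).1.le)⟩
    refine ⟨∑ α, c α • b α, ?_⟩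
    funext β
    rw [map_sum, Finset.sum_apply, Finset.sum_eq_single β]
    · rw [map_smul, Pi.smul_apply, hev, hqe, lagrangeShape_latticeNode hk h β.2 β.2]
      simp
    · intro α _ hne
      rw [map_smul, Pi.smul_apply, hev, hqe, lagrangeShape_latticeNode hk h α.2 β.2,
        if_neg fun hc => hne (Subtype.ext hc), smul_zero]
    · simp
  have hfin : Module.finrank ℝ V = Module.finrank ℝ (s.piAntidiag k → ℝ) := by
    refine le_antisymm ?_ (LinearMap.finrank_le_finrank_of_surjective hsurj)
    rw [Module.finrank_fintype_fun_eq_card, Fintype.card_coe]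
    exact finrank_restrictTotalDegree_le h k
  have hinj := (LinearMap.injective_iff_surjective_of_finrank_eq_finrank hfin).2 hsurj
  have hz : (⟨p, (MvPolynomial.mem_restrictTotalDegree _ _ _).2 hp⟩ : V) = 0 := by
    apply hinj
    rw [map_zero]
    funext α
    rw [hev]
    exact h0 _ (mem_lagrangeNodes_iff.2 ⟨α, α.2, rfl⟩)
  exact congrArg Subtype.val hz

/-- Serves twice: as uniqueness of the interpolant and, with `g = v`, as reproduction of
polynomials. -/
theorem IsPolyOn.eq_localInterp {k : ℕ} (hk : 1 ≤ k) {s : Finset R3} (h : IsTet s)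
    {v g : R3 → ℝ} (hv : IsPolyOn k (simplexHull s) v)
    (hvg : ∀ x ∈ lagrangeNodes k s, v x = g x) :
    ∀ x ∈ simplexHull s, v x = localInterp k s g x := by
  obtain ⟨p, hp, hpv⟩ := hv
  obtain ⟨q, hq, hqv⟩ := isPolyOn_localInterp k s g univ
  have : p - q = 0 := by
    refine eq_zero_of_eval_latticeNode hk h
      ((MvPolynomial.totalDegree_sub _ _).trans (max_le hp hq)) ?_
    intro x hx
    obtain ⟨α, hα, rfl⟩ := mem_lagrangeNodes_iff.1 hx
    rw [map_sub, ← hqv _ (mem_univ _),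
      ← hpv _ (latticeNode_mem hk h (Finset.mem_piAntidiag.1 hα).1), hvg _ hx,
      localInterp_latticeNode hk h g hα, sub_self]
  intro x hx
  rw [hpv x hx, hqv x (mem_univ _), sub_eq_zero.1 this]

theorem contDiff_localInterp (k : ℕ) (s : Finset R3) (g : R3 → ℝ) :
    ContDiff ℝ (⊤ : ℕ∞) (localInterp k s g) := by
  have hb : ∀ v, ContDiff ℝ (⊤ : ℕ∞) (fun x => bary s v x) := fun v => by
    have : (fun x => bary s v x) = fun x =>
        LinearMap.toContinuousLinearMap (bary s v).linear x + bary s v 0 :=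
      (bary s v).decomp
    rw [this]
    fun_prop
  unfold localInterp lagrangeShape
  refine ContDiff.sum fun α _ => contDiff_const.mul ?_
  refine contDiff_prod fun v _ => contDiff_prod fun j _ => ?_
  exact ((contDiff_const.mul (hb v)).sub contDiff_const).div_const _

/-! ### Inverse estimate between the maximum and the `L²` norm -/

/-- The number `∑_{j ≤ k} binom (k+1) (j+1)²`. -/
def extrapolationConst (k : ℕ) : ℝ :=
  ∑ j ∈ Finset.range (k + 1), (((k + 1).choose (j + 1) : ℕ) : ℝ) ^ 2

/-- The forward difference of order `k + 1` annihilates `P`, which expresses `P(0)` through `P(1),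
…, P(k+1)` with binomial coefficients; Cauchy–Schwarz does the rest. -/
theorem Polynomial.sq_eval_zero_le {k : ℕ} {P : Polynomial ℝ} (hP : P.natDegree ≤ k) :
    P.eval 0 ^ 2 ≤
      extrapolationConst k * ∑ j ∈ Finset.range (k + 1), P.eval ((j : ℝ) + 1) ^ 2 := by
  have h := congrFun (Polynomial.fwdDiff_iter_eq_zero_of_degree_lt (Nat.lt_succ_of_le hP)) 0
  rw [fwdDiff_iter_eq_sum_shift, Finset.sum_range_succ'] at h
  simp only [zero_smul, add_zero, zero_add, Nat.choose_zero_right, Nat.cast_one, mul_one,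
    Pi.zero_apply, zsmul_eq_mul, nsmul_eq_mul, Nat.cast_add, Int.cast_mul, Int.cast_pow,
    Int.cast_neg, Int.cast_one, Int.cast_natCast] at h
  have hsq : ∀ m : ℕ, ((-1 : ℝ) ^ m) ^ 2 = 1 := fun m => by rw [← pow_mul, mul_comm, pow_mul]; simp
  have h2 : P.eval 0 ^ 2 = (∑ j ∈ Finset.range (k + 1),
      ((-1 : ℝ) ^ (k + 1 - (j + 1)) * ((k + 1).choose (j + 1) : ℕ)) *
        P.eval ((j : ℝ) + 1)) ^ 2 := by
    rw [eq_neg_of_add_eq_zero_left h, neg_sq, mul_pow, hsq, one_mul]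
  rw [h2]
  refine (Finset.sum_mul_sq_le_sq_mul_sq _ _ _).trans (le_of_eq ?_)
  rw [extrapolationConst]
  congr 1
  exact Finset.sum_congr rfl fun j _ => by rw [mul_pow, hsq, one_mul]

/-- One-dimensional extrapolation along the line from `x` to `y`, scaled so that the sample points
`1, …, k + 1` fall on the segment and the last of them is `y`. -/
theorem sq_eval_le_of_totalDegree_le {k : ℕ} {p : MvPolynomial (Fin 3) ℝ} (hp : p.totalDegree ≤ k)
    (x y : R3) :
    MvPolynomial.eval (fun i => x i) p ^ 2 ≤ extrapolationConst k *
      ∑ j ∈ Finset.range (k + 1), MvPolynomial.eval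
        (fun i => (AffineMap.homothety x (((j : ℝ) + 1) / (k + 1)) y : R3) i) p ^ 2 := by
  let f : Fin 3 → Polynomial ℝ := fun i =>
    Polynomial.C (x i) + Polynomial.C ((y i - x i) / (k + 1)) * Polynomial.X
  have hdeg : (MvPolynomial.aeval f p).natDegree ≤ k := by
    refine (MvPolynomial.aeval_natDegree_le p hp f (n := 1) fun i => ?_).trans (by simp)
    refine (Polynomial.natDegree_add_le _ _).trans (max_le (by simp) ?_)
    exact (Polynomial.natDegree_C_mul_le _ _).trans Polynomial.natDegree_X_le
  have hev : ∀ t : ℝ, (MvPolynomial.aeval f p).eval t =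
      MvPolynomial.eval (fun i => x i + (y i - x i) / (k + 1) * t) p := by
    intro t
    rw [← Polynomial.coe_evalRingHom, MvPolynomial.map_aeval, MvPolynomial.coe_eval₂Hom,
      MvPolynomial.eval, MvPolynomial.coe_eval₂Hom]
    congr 1
    · ext a; simp
    · funext i; simp [f]
  have := Polynomial.sq_eval_zero_le hdeg
  simp only [hev, mul_zero, add_zero] at this
  convert this using 6 with j _
  funext i
  simp [AffineMap.homothety_apply]
  ring

theorem lintegral_comp_homothety (x : R3) {r : ℝ} (hr : 0 < r) {f : R3 → ℝ≥0∞}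
    (hf : Measurable f) :
    ∫⁻ y, f (AffineMap.homothety x r y) = ENNReal.ofReal ((r ^ 3)⁻¹) * ∫⁻ y, f y := by
  have h1 : ∀ y : R3, AffineMap.homothety x r y = r • y + (x - r • x) := by
    intro y
    simp [AffineMap.homothety_apply, smul_sub]
    abel
  simp only [h1]
  have h2 : Measurable fun z : R3 => f (z + (x - r • x)) := hf.comp (measurable_add_const _)
  have h3 := lintegral_map (μ := (volume : Measure R3)) h2 (measurable_const_smul r)
  rw [← h3, Measure.map_addHaar_smul _ hr.ne', lintegral_smul_measure,
    lintegral_add_right_eq_self]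
  simp [abs_of_pos hr]

theorem setLIntegral_comp_homothety_le {E : Set R3} (hE : Convex ℝ E) (hEm : MeasurableSet E)
    {x : R3} (hx : x ∈ E) {r : ℝ} (hr : 0 < r) (hr1 : r ≤ 1) {f : R3 → ℝ≥0∞}
    (hf : Measurable f) :
    ∫⁻ y in E, f (AffineMap.homothety x r y) ≤ ENNReal.ofReal ((r ^ 3)⁻¹) * ∫⁻ y in E, f y := by
  rw [← lintegral_indicator hEm, ← lintegral_indicator hEm,
    ← lintegral_comp_homothety x hr (hf.indicator hEm)]
  refine lintegral_mono fun y => ?_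
  by_cases hy : y ∈ E
  · rw [indicator_of_mem hy, indicator_of_mem]
    rw [AffineMap.homothety_eq_lineMap]
    exact hE.lineMap_mem hx hy ⟨hr.le, hr1⟩
  · rw [indicator_of_notMem hy]; exact zero_le

theorem eLpNorm_two_sq_eq_lintegral (v : R3 → ℝ) (μ : Measure R3) :
    eLpNorm v 2 μ ^ 2 = ∫⁻ x, ENNReal.ofReal (v x ^ 2) ∂μ := by
  have := eLpNorm_nnreal_pow_eq_lintegral (f := v) (μ := μ) (p := 2) two_ne_zero
  simp only [ENNReal.coe_ofNat, NNReal.coe_ofNat, ENNReal.rpow_ofNat] at this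
  rw [this]
  refine lintegral_congr fun x => ?_
  rw [← sq_abs, ENNReal.ofReal_pow (abs_nonneg _), ← Real.enorm_eq_ofReal_abs]

/-- The constant of the inverse estimate between `L^∞` and `L²`. -/
def inverseConst (k : ℕ) : ℝ := extrapolationConst k * ((k + 1) * (k + 1) ^ 3)

theorem extrapolationConst_nonneg (k : ℕ) : 0 ≤ extrapolationConst k :=
  Finset.sum_nonneg fun _ _ => sq_nonneg _

theorem inverseConst_nonneg (k : ℕ) : 0 ≤ inverseConst k :=
  mul_nonneg (extrapolationConst_nonneg k) (by positivity)

theorem measurable_eval_mvPolynomial (p : MvPolynomial (Fin 3) ℝ) :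
    Measurable fun x : R3 => MvPolynomial.eval (fun i => x i) p :=
  (p.continuous_eval.comp (by fun_prop : Continuous fun x : R3 => fun i => x i)).measurable

/-- Integrate the extrapolation inequality over the endpoint `y ∈ E`. By convexity the homotheties
centred at `x` with ratio at most `1` keep `E` inside itself, so each sample contributes at most a
Jacobian times the full integral. The constant does not depend on the shape of `E`. -/
theorem IsPolyOn.sq_mul_volume_le {k : ℕ} {E : Set R3} (hE : Convex ℝ E) (hEm : MeasurableSet E)
    {v : R3 → ℝ} (hv : IsPolyOn k E v) {x : R3} (hx : x ∈ E) :
    ENNReal.ofReal (v x ^ 2) * volume E ≤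
      ENNReal.ofReal (inverseConst k) * eLpNorm v 2 (volume.restrict E) ^ 2 := by
  obtain ⟨p, hp, hpv⟩ := hv
  let F : R3 → ℝ≥0∞ := fun y => ENNReal.ofReal (MvPolynomial.eval (fun i => y i) p ^ 2)
  have hF : Measurable F := ((measurable_eval_mvPolynomial p).pow_const 2).ennreal_ofReal
  have hFv : eLpNorm v 2 (volume.restrict E) ^ 2 = ∫⁻ y in E, F y := by
    rw [eLpNorm_two_sq_eq_lintegral]
    exact setLIntegral_congr_fun hEm fun y hy => by simp only [F, hpv y hy]
  rw [hFv, ← setLIntegral_const, hpv x hx]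
  have hB := extrapolationConst_nonneg k
  calc ∫⁻ _ in E, ENNReal.ofReal (MvPolynomial.eval (fun i => x i) p ^ 2)
      ≤ ∫⁻ y in E, ENNReal.ofReal (extrapolationConst k) * ∑ j ∈ Finset.range (k + 1),
          F (AffineMap.homothety x (((j : ℝ) + 1) / (k + 1)) y) := by
        refine lintegral_mono fun y => ?_
        refine (ENNReal.ofReal_le_ofReal (sq_eval_le_of_totalDegree_le hp x y)).trans ?_
        rw [ENNReal.ofReal_mul hB, ENNReal.ofReal_sum_of_nonneg fun _ _ => sq_nonneg _]
    _ = ENNReal.ofReal (extrapolationConst k) * ∑ j ∈ Finset.range (k + 1),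
          ∫⁻ y in E, F (AffineMap.homothety x (((j : ℝ) + 1) / (k + 1)) y) := by
        have hm : ∀ j : ℕ, Measurable fun y : R3 =>
            F (AffineMap.homothety x (((j : ℝ) + 1) / (k + 1)) y) := fun j =>
          hF.comp (AffineMap.homothety_continuous x _).measurable
        rw [lintegral_const_mul _ (Finset.measurable_sum _ fun j _ => hm j),
          lintegral_finsetSum _ fun j _ => hm j]
    _ ≤ ENNReal.ofReal (extrapolationConst k) * ∑ j ∈ Finset.range (k + 1),
          ENNReal.ofReal ((k + 1) ^ 3) * ∫⁻ y in E, F y := by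
        gcongr with j hj
        have hj' : (j : ℝ) + 1 ≤ k + 1 := by
          have := Finset.mem_range.1 hj
          exact_mod_cast this
        have hk0 : (0 : ℝ) < k + 1 := by positivity
        refine (setLIntegral_comp_homothety_le hE hEm hx (by positivity)
          ((div_le_one hk0).2 hj') hF).trans ?_
        gcongr
        -- The smallest ratio is `1 / (k + 1)`, so every Jacobian is at most `(k + 1) ^ 3`.
        rw [← inv_pow, inv_div]
        gcongr
        rw [div_le_iff₀ (by positivity)]
        nlinarith [(Nat.cast_nonneg j : (0 : ℝ) ≤ j)]
    _ = ENNReal.ofReal (inverseConst k) * ∫⁻ y in E, F y := by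
        rw [Finset.sum_const, Finset.card_range, nsmul_eq_mul, inverseConst,
          ENNReal.ofReal_mul hB, ENNReal.ofReal_mul (by positivity)]
        have : ((k + 1 : ℕ) : ℝ≥0∞) = ENNReal.ofReal ((k : ℝ) + 1) := by
          rw [← ENNReal.ofReal_natCast]; simp
        rw [this]
        ring

/-! ### Calculus of weak gradients -/

theorem MeasureTheory.LocallyIntegrableOn.integrable_mul_of_tsupport_subset {U : Set R3}
    {f ψ : R3 → ℝ} (hf : LocallyIntegrableOn f U) (hψ : Continuous ψ) (hc : HasCompactSupport ψ)
    (hs : tsupport ψ ⊆ U) : Integrable fun x => f x * ψ x := by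
  have h1 : IntegrableOn f (tsupport ψ) := hf.integrableOn_compact_subset hs hc
  refine (integrableOn_iff_integrable_of_support_subset ?_).1
    (h1.mul_continuousOn hψ.continuousOn hc)
  exact (Function.support_mul_subset_right _ _).trans (subset_tsupport ψ)

theorem tsupport_fderiv_apply_subset_tsupport {φ : R3 → ℝ} (z : R3) :
    tsupport (fun x => fderiv ℝ φ x z) ⊆ tsupport φ :=
  (tsupport_comp_subset (g := fun L : R3 →L[ℝ] ℝ => L z) rfl _).trans (tsupport_fderiv_subset ℝ)

theorem ContDiff.continuous_fderiv_apply_const {φ : R3 → ℝ} (hφ : ContDiff ℝ (⊤ : ℕ∞) φ) (z : R3) :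
    Continuous fun x => fderiv ℝ φ x z :=
  (hφ.continuous_fderiv (by simp)).clm_apply continuous_const

theorem setIntegral_eq_integral_of_tsupport_subset {U : Set R3} {f ψ : R3 → ℝ}
    (hs : tsupport ψ ⊆ U) : ∫ x in U, f x * ψ x = ∫ x, f x * ψ x :=
  setIntegral_eq_integral_of_forall_compl_eq_zero fun x hx => by
    rw [image_eq_zero_of_notMem_tsupport fun h => hx (hs h), mul_zero]

/-- Test functions are supported in `U`, so the integrals may be taken over the whole space. -/
theorem hasWeakGrad_iff {U : Set R3} {u : R3 → ℝ} {G : R3 → R3} :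
    HasWeakGrad U u G ↔ LocallyIntegrableOn u U ∧ (∀ i, LocallyIntegrableOn (fun x => G x i) U) ∧
      ∀ φ : R3 → ℝ, ContDiff ℝ (⊤ : ℕ∞) φ → HasCompactSupport φ → tsupport φ ⊆ U → ∀ i,
        ∫ x, u x * fderiv ℝ φ x (EuclideanSpace.single i 1) = -∫ x, G x i * φ x := by
  have key : ∀ φ : R3 → ℝ, tsupport φ ⊆ U → ∀ i : Fin 3,
      ((∫ x in U, u x * iteratedFDeriv ℝ 1 φ x (fun _ => EuclideanSpace.single i (1 : ℝ)) =
        (-1 : ℝ) ^ 1 * ∫ x in U, G x i * φ x) ↔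
        ∫ x, u x * fderiv ℝ φ x (EuclideanSpace.single i 1) = -∫ x, G x i * φ x) := by
    intro φ hφ i
    simp only [iteratedFDeriv_one_apply]
    rw [setIntegral_eq_integral_of_tsupport_subset
        ((tsupport_fderiv_apply_subset_tsupport _).trans hφ),
      setIntegral_eq_integral_of_tsupport_subset hφ]
    simp
  constructor
  · intro h
    exact ⟨(h 0).1, fun i => (h i).2.1, fun φ h1 h2 h3 i => (key φ h3 i).1 ((h i).2.2 φ h1 h2 h3)⟩
  · intro h i
    exact ⟨h.1, h.2.1 i, fun φ h1 h2 h3 => (key φ h3 i).2 (h.2.2 φ h1 h2 h3 i)⟩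

theorem HasWeakGrad.mono {U V : Set R3} {u : R3 → ℝ} {G : R3 → R3} (h : HasWeakGrad U u G)
    (hVU : V ⊆ U) : HasWeakGrad V u G := by
  rw [hasWeakGrad_iff] at h ⊢
  exact ⟨h.1.mono_set hVU, fun i => (h.2.1 i).mono_set hVU,
    fun φ h1 h2 h3 => h.2.2 φ h1 h2 (h3.trans hVU)⟩

theorem HasWeakGrad.congr {U : Set R3} (hU : IsOpen U) {u w : R3 → ℝ} {G : R3 → R3}
    (h : HasWeakGrad U u G) (huw : EqOn u w U) : HasWeakGrad U w G := by
  rw [hasWeakGrad_iff] at h ⊢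
  refine ⟨h.1.congr ?_, h.2.1, fun φ h1 h2 h3 i => ?_⟩
  · exact (ae_restrict_iff' hU.measurableSet).2 (Eventually.of_forall huw)
  · rw [← h.2.2 φ h1 h2 h3 i]
    refine integral_congr_ae (Eventually.of_forall fun x => ?_)
    by_cases hx : x ∈ U
    · simp only [huw hx]
    · have : fderiv ℝ φ x (EuclideanSpace.single i 1) = 0 :=
        image_eq_zero_of_notMem_tsupport (f := fun x => fderiv ℝ φ x (EuclideanSpace.single i 1))
          fun hc => hx (h3 (tsupport_fderiv_apply_subset_tsupport _ hc))
      simp only [this, mul_zero]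

theorem HasWeakGrad.sub {U : Set R3} {u w : R3 → ℝ} {G H : R3 → R3}
    (hu : HasWeakGrad U u G) (hw : HasWeakGrad U w H) :
    HasWeakGrad U (u - w) (fun x => G x - H x) := by
  rw [hasWeakGrad_iff] at hu hw ⊢
  refine ⟨hu.1.sub hw.1, fun i => ?_, fun φ h1 h2 h3 i => ?_⟩
  · simpa using! (hu.2.1 i).sub (hw.2.1 i)
  · have hφ' := h1.continuous_fderiv_apply_const (EuclideanSpace.single i 1)
    have hc' : HasCompactSupport fun x => fderiv ℝ φ x (EuclideanSpace.single i 1) :=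
      h2.fderiv_apply ℝ _
    have hs' := (tsupport_fderiv_apply_subset_tsupport (φ := φ) (EuclideanSpace.single i 1)).trans h3
    simp only [Pi.sub_apply, PiLp.sub_apply, sub_mul]
    rw [integral_sub (hu.1.integrable_mul_of_tsupport_subset hφ' hc' hs')
        (hw.1.integrable_mul_of_tsupport_subset hφ' hc' hs'),
      integral_sub ((hu.2.1 i).integrable_mul_of_tsupport_subset h1.continuous h2 h3)
        ((hw.2.1 i).integrable_mul_of_tsupport_subset h1.continuous h2 h3),
      hu.2.2 φ h1 h2 h3 i, hw.2.2 φ h1 h2 h3 i]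
    ring

theorem gradient_apply (w : R3 → ℝ) (x : R3) (i : Fin 3) :
    gradient w x i = fderiv ℝ w x (EuclideanSpace.single i 1) := by
  have : inner ℝ (gradient w x) (EuclideanSpace.single i (1 : ℝ)) =
      fderiv ℝ w x (EuclideanSpace.single i 1) := by
    rw [gradient, InnerProductSpace.toDual_symm_apply]
  rw [← this, EuclideanSpace.inner_single_right]
  simp only [one_mul, conj_trivial]

theorem ContDiff.hasWeakGrad {w : R3 → ℝ} (hw : ContDiff ℝ (⊤ : ℕ∞) w) (U : Set R3) :
    HasWeakGrad U w (gradient w) := by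
  rw [hasWeakGrad_iff]
  simp only [gradient_apply]
  refine ⟨hw.continuous.locallyIntegrable.locallyIntegrableOn _, fun i =>
    (hw.continuous_fderiv_apply_const _).locallyIntegrable.locallyIntegrableOn _,
    fun φ h1 h2 h3 i => ?_⟩
  have hd : ∀ {f : R3 → ℝ}, ContDiff ℝ (⊤ : ℕ∞) f → Differentiable ℝ f := fun hf =>
    hf.differentiable (by simp)
  refine integral_mul_fderiv_eq_neg_fderiv_mul_of_integrable ?_ ?_ ?_
    (fun x _ => hd hw x) (fun x _ => hd h1 x)
  · exact ((hw.continuous_fderiv_apply_const _).mul h1.continuous).integrable_of_hasCompactSupport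
      h2.mul_left
  · exact (hw.continuous.mul (h1.continuous_fderiv_apply_const _)).integrable_of_hasCompactSupport
      (HasCompactSupport.mul_left (h2.fderiv_apply ℝ _))
  · exact (hw.continuous.mul h1.continuous).integrable_of_hasCompactSupport h2.mul_left

/-- The fundamental lemma of the calculus of variations. It identifies the global weak gradient with
the broken one on each element. -/
theorem HasWeakGrad.ae_eq {U : Set R3} (hU : IsOpen U) {u : R3 → ℝ} {G H : R3 → R3}
    (hG : HasWeakGrad U u G) (hH : HasWeakGrad U u H) : G =ᵐ[volume.restrict U] H := by
  rw [hasWeakGrad_iff] at hG hH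
  have key : ∀ i, ∀ᵐ x, x ∈ U → G x i - H x i = 0 := by
    intro i
    refine hU.ae_eq_zero_of_integral_contDiff_smul_eq_zero ((hG.2.1 i).sub (hH.2.1 i)) ?_
    intro φ h1 h2 h3
    have e : ∀ x, φ x • (G x i - H x i) = G x i * φ x - H x i * φ x :=
      fun x => by rw [smul_eq_mul]; ring
    simp only [e]
    rw [integral_sub ((hG.2.1 i).integrable_mul_of_tsupport_subset h1.continuous h2 h3)
        ((hH.2.1 i).integrable_mul_of_tsupport_subset h1.continuous h2 h3), sub_eq_zero]
    exact neg_injective ((hG.2.2 φ h1 h2 h3 i).symm.trans (hH.2.2 φ h1 h2 h3 i))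
  refine (ae_restrict_iff' hU.measurableSet).2 ?_
  filter_upwards [ae_all_iff.2 key] with x hx hxU
  ext i
  exact sub_eq_zero.1 (hx i hxU)

theorem HasWeakGrad.integral_mul_fderiv {U : Set R3} {u : R3 → ℝ} {G : R3 → R3}
    (h : HasWeakGrad U u G) {φ : R3 → ℝ} (h1 : ContDiff ℝ (⊤ : ℕ∞) φ) (h2 : HasCompactSupport φ)
    (h3 : tsupport φ ⊆ U) (z : R3) :
    ∫ x, u x * fderiv ℝ φ x z = -∫ x, inner ℝ z (G x) * φ x := by
  rw [hasWeakGrad_iff] at h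
  have hz : z = ∑ i, z i • EuclideanSpace.single i (1 : ℝ) := by
    ext j
    simp [Finset.sum_apply, Pi.single_apply]
  have e1 : ∀ x, u x * fderiv ℝ φ x z =
      ∑ i, z i * (u x * fderiv ℝ φ x (EuclideanSpace.single i 1)) := by
    intro x
    conv_lhs => rw [hz]
    rw [map_sum, Finset.mul_sum]
    exact Finset.sum_congr rfl fun i _ => by rw [map_smul, smul_eq_mul]; ring
  have e2 : ∀ x, inner ℝ z (G x) * φ x = ∑ i, z i * (G x i * φ x) := by
    intro x
    rw [PiLp.inner_apply, Finset.sum_mul]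
    exact Finset.sum_congr rfl fun i _ => by simp; ring
  simp only [e1, e2]
  rw [integral_finsetSum, integral_finsetSum, ← Finset.sum_neg_distrib]
  · refine Finset.sum_congr rfl fun i _ => ?_
    rw [integral_const_mul, integral_const_mul, h.2.2 φ h1 h2 h3 i, mul_neg]
  · exact fun i _ =>
      ((h.2.1 i).integrable_mul_of_tsupport_subset h1.continuous h2 h3).const_mul _
  · exact fun i _ => (h.1.integrable_mul_of_tsupport_subset
      (h1.continuous_fderiv_apply_const _) (h2.fderiv_apply ℝ _)
      ((tsupport_fderiv_apply_subset_tsupport _).trans h3)).const_mul _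

/-! ### Mollification and Lipschitz representatives -/

open scoped Convolution in
-- The derivative of the mollification in direction `z` is the average of `⟨z, G⟩` against the
-- probability density `t ↦ φ (x - t)`. This density is an admissible test function because its
-- support stays in `U`.
theorem HasWeakGrad.norm_fderiv_convolution_le {U : Set R3} (hU : IsOpen U) {u : R3 → ℝ}
    {G : R3 → R3} (hu : IntegrableOn u U) (h : HasWeakGrad U u G) {M : ℝ} (hM0 : 0 ≤ M)
    (hM : ∀ᵐ x ∂volume.restrict U, ‖G x‖ ≤ M) {φ : R3 → ℝ} (h1 : ContDiff ℝ (⊤ : ℕ∞) φ)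
    (h2 : HasCompactSupport φ) (hφ0 : ∀ x, 0 ≤ φ x) (hφ1 : ∫ x, φ x = 1) {r : ℝ}
    (hr : Function.support φ ⊆ Metric.ball 0 r) {x : R3} (hx : Metric.closedBall x r ⊆ U) :
    DifferentiableAt ℝ (φ ⋆[ContinuousLinearMap.lsmul ℝ ℝ, volume] U.indicator u) x ∧
      ‖fderiv ℝ (φ ⋆[ContinuousLinearMap.lsmul ℝ ℝ, volume] U.indicator u) x‖ ≤ M := by
  have hf : LocallyIntegrable (U.indicator u) :=
    ((integrable_indicator_iff hU.measurableSet).2 hu).locallyIntegrable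
  rw [← convolution_flip]
  have hder := h2.hasFDerivAt_convolution_right (ContinuousLinearMap.lsmul ℝ ℝ).flip hf
    (h1.of_le (by simp)) x (μ := (volume : Measure R3))
  refine ⟨hder.differentiableAt, ?_⟩
  rw [hder.fderiv]
  refine ContinuousLinearMap.opNorm_le_bound _ hM0 fun z => ?_
  rw [convolution_precompR_apply _ hf (h2.fderiv ℝ) (h1.continuous_fderiv (by simp))]
  let ψ : R3 → ℝ := fun t => φ (x - t)
  have hψ : ContDiff ℝ (⊤ : ℕ∞) ψ := h1.comp (contDiff_const.sub contDiff_id)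
  have hψs : tsupport ψ ⊆ Metric.closedBall x r := by
    refine closure_minimal (fun t ht => ?_) Metric.isClosed_closedBall
    have := hr (show x - t ∈ Function.support φ from ht)
    rw [mem_ball_zero_iff] at this
    rw [Metric.mem_closedBall, dist_comm, dist_eq_norm]
    exact this.le
  have hψc : HasCompactSupport ψ :=
    HasCompactSupport.intro' (isCompact_closedBall x r) Metric.isClosed_closedBall
      fun t ht => image_eq_zero_of_notMem_tsupport fun hc => ht (hψs hc)
  have hψd : ∀ t, fderiv ℝ ψ t z = -fderiv ℝ φ (x - t) z := by
    intro t
    have hd := (h1.differentiable (by simp) (x - t)).hasFDerivAt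
    have := hd.comp t ((hasFDerivAt_id (𝕜 := ℝ) t).const_sub x)
    rw [HasFDerivAt.fderiv (f := ψ) this]
    simp
  have hψi : ∫ t, ψ t = 1 := by rw [← hφ1]; exact integral_sub_left_eq_self φ volume x
  have hconv : ((U.indicator u) ⋆[(ContinuousLinearMap.lsmul ℝ ℝ).flip, volume]
      fun a => fderiv ℝ φ a z) x = ∫ t, inner ℝ z (G t) * ψ t := by
    rw [← neg_inj, ← h.integral_mul_fderiv hψ hψc (hψs.trans hx) z, convolution_def,
      ← integral_neg]
    refine integral_congr_ae (Eventually.of_forall fun t => ?_)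
    simp only [ContinuousLinearMap.flip_apply, ContinuousLinearMap.lsmul_apply, smul_eq_mul, hψd]
    by_cases ht : t ∈ U
    · rw [indicator_of_mem ht]; ring
    · have : fderiv ℝ ψ t z = 0 :=
        image_eq_zero_of_notMem_tsupport (f := fun t => fderiv ℝ ψ t z)
          fun hc => ht (hx (hψs (tsupport_fderiv_apply_subset_tsupport _ hc)))
      rw [hψd] at this
      rw [this, indicator_of_notMem ht]; simp
  rw [hconv]
  have hint : Integrable fun t => M * ‖z‖ * ψ t :=
    (hψ.continuous.integrable_of_hasCompactSupport hψc).const_mul _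
  refine (norm_integral_le_of_norm_le hint ?_).trans (by rw [integral_const_mul, hψi, mul_one])
  filter_upwards [(ae_restrict_iff' hU.measurableSet).1 hM] with t ht
  by_cases htU : t ∈ U
  · rw [norm_mul, Real.norm_of_nonneg (hφ0 _)]
    refine mul_le_mul_of_nonneg_right ((norm_inner_le_norm _ _).trans ?_) (hφ0 _)
    rw [mul_comm]
    exact mul_le_mul_of_nonneg_right (ht htU) (norm_nonneg _)
  · have : ψ t = 0 := image_eq_zero_of_notMem_tsupport fun hc => htU (hx (hψs hc))
    simp [this]

open scoped Convolution Topology NNReal in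
/-- A function with bounded weak gradient on a convex open set has a Lipschitz representative. -/
theorem HasWeakGrad.exists_lipschitzWith {U : Set R3} (hU : IsOpen U) (hc : Convex ℝ U)
    {u : R3 → ℝ} {G : R3 → R3} (hu : IntegrableOn u U) (h : HasWeakGrad U u G) {M : ℝ≥0}
    (hM : ∀ᵐ x ∂volume.restrict U, ‖G x‖ ≤ M) :
    ∃ g : R3 → ℝ, LipschitzWith M g ∧ g =ᵐ[volume.restrict U] u := by
  let φ : ℕ → ContDiffBump (0 : R3) := fun n =>
    -- The fixed ratio of the two radii is what pointwise almost everywhere convergence of the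
    -- mollifications requires.
    ⟨1 / (n + 1), 2 / (n + 1), by positivity, by gcongr; norm_num⟩
  have hφ : Tendsto (fun n => (φ n).rOut) atTop (𝓝 0) := by
    have := (tendsto_one_div_add_atTop_nhds_zero_nat (𝕜 := ℝ)).const_mul 2
    rw [mul_zero] at this
    refine this.congr fun n => ?_
    simp [φ, div_eq_mul_inv]
  have hφ' : ∀ᶠ n in atTop, (φ n).rOut ≤ 2 * (φ n).rIn :=
    Eventually.of_forall fun n => by simp [φ, div_eq_mul_inv]
  have hf : LocallyIntegrable (U.indicator u) :=
    ((integrable_indicator_iff hU.measurableSet).2 hu).locallyIntegrable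
  have hae := ContDiffBump.ae_convolution_tendsto_right_of_locallyIntegrable (μ := volume) hφ hφ' hf
  let S : Set R3 := {x | x ∈ U ∧ Tendsto (fun n => ((φ n).normed volume
    ⋆[ContinuousLinearMap.lsmul ℝ ℝ, volume] U.indicator u) x) atTop (𝓝 (U.indicator u x))}
  have hlip : LipschitzOnWith M u S := by
    refine LipschitzOnWith.of_dist_le_mul fun x hx y hy => ?_
    have hcomp : IsCompact (segment ℝ x y) := by
      rw [segment_eq_image_lineMap]
      exact isCompact_Icc.image AffineMap.lineMap_continuous
    -- A compact segment in `U` has a closed thickening in `U`. Mollifiers of radius below `δ` thus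
    -- give derivatives bounded by `M` along the whole segment; the mean value inequality passes to
    -- the limit at its endpoints.
    obtain ⟨δ, hδ, hδU⟩ := hcomp.exists_cthickening_subset_open hU (hc.segment_subset hx.1 hy.1)
    have hx2 := hx.2
    have hy2 := hy.2
    rw [indicator_of_mem hx.1] at hx2
    rw [indicator_of_mem hy.1] at hy2
    refine le_of_tendsto (hx2.dist hy2) ?_
    filter_upwards [hφ.eventually (gt_mem_nhds hδ)] with n hn
    have key := fun w (hw : w ∈ segment ℝ x y) =>
      h.norm_fderiv_convolution_le hU hu M.2 hM (φ n).contDiff_normed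
        (φ n).hasCompactSupport_normed (φ n).nonneg_normed (φ n).integral_normed
        (φ n).support_normed_eq.subset (x := w)
        ((Metric.closedBall_subset_cthickening hw _).trans
          ((Metric.cthickening_mono hn.le _).trans hδU))
    rw [dist_comm, dist_eq_norm, dist_comm x, dist_eq_norm]
    exact (convex_segment x y).norm_image_sub_le_of_norm_fderiv_le (fun w hw => (key w hw).1)
      (fun w hw => (key w hw).2) (left_mem_segment ℝ x y) (right_mem_segment ℝ x y)
  obtain ⟨g, hg, hgu⟩ := hlip.extend_real
  refine ⟨g, hg, (ae_restrict_iff' hU.measurableSet).2 ?_⟩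
  filter_upwards [hae] with x hx hxU
  exact (hgu ⟨hxU, hx⟩).symm

/-! ### Topology of elements and continuous representatives -/

theorem convex_simplexHull (s : Finset R3) : Convex ℝ (simplexHull s) := convex_convexHull ℝ _

theorem isCompact_simplexHull (s : Finset R3) : IsCompact (simplexHull s) :=
  s.finite_toSet.isCompact_convexHull (𝕜 := ℝ)

theorem measurableSet_simplexHull (s : Finset R3) : MeasurableSet (simplexHull s) :=
  (isCompact_simplexHull s).isClosed.measurableSet

theorem IsTet.interior_nonempty {s : Finset R3} (h : IsTet s) :
    (interior (simplexHull s)).Nonempty := by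
  rw [simplexHull, interior_convexHull_nonempty_iff_affineSpan_eq_top]
  have := h.affineSpan_eq_top
  simpa using this

theorem IsTet.closure_interior {s : Finset R3} (h : IsTet s) :
    closure (interior (simplexHull s)) = simplexHull s := by
  rw [(convex_simplexHull s).closure_interior_eq_closure_of_nonempty_interior h.interior_nonempty]
  exact (isCompact_simplexHull s).isClosed.closure_eq

theorem restrict_interior_simplexHull (s : Finset R3) :
    (volume : Measure R3).restrict (interior (simplexHull s)) = volume.restrict (simplexHull s) :=
  Measure.restrict_congr_set
    (interior_ae_eq_of_null_frontier ((convex_simplexHull s).addHaar_frontier volume))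

theorem IsConvexPolyhedron.isOpen {Ω : Set R3} (h : IsConvexPolyhedron Ω) : IsOpen Ω := by
  obtain ⟨-, F, rfl⟩ := h
  exact isOpen_interior

theorem IsConvexPolyhedron.convex {Ω : Set R3} (h : IsConvexPolyhedron Ω) : Convex ℝ Ω := by
  obtain ⟨-, F, rfl⟩ := h
  exact (convex_convexHull ℝ _).interior

theorem IsConvexPolyhedron.isBounded {Ω : Set R3} (h : IsConvexPolyhedron Ω) :
    Bornology.IsBounded Ω := by
  obtain ⟨-, F, rfl⟩ := h
  exact (F.finite_toSet.isCompact_convexHull (𝕜 := ℝ)).isBounded.subset interior_subset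

theorem IsConvexPolyhedron.interior_closure {Ω : Set R3} (h : IsConvexPolyhedron Ω) :
    interior (closure Ω) = Ω := by
  rw [h.convex.interior_closure_eq_interior_of_nonempty_interior, h.isOpen.interior_eq]
  rw [h.isOpen.interior_eq]
  exact h.1

theorem abs_le_on_closure_of_ae {U : Set R3} (hU : IsOpen U) {g : R3 → ℝ}
    (hg : ContinuousOn g (closure U)) {c : ℝ} (h : ∀ᵐ x ∂volume.restrict U, |g x| ≤ c) :
    ∀ x ∈ closure U, |g x| ≤ c := by
  -- The inequality is encoded as an equality of continuous functions, which extends from almost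
  -- everywhere to the open set and then to its closure.
  have h1 : EqOn (fun x => max |g x| c) (fun _ => c) U :=
    Measure.eqOn_open_of_ae_eq (μ := volume) (h.mono fun x hx => max_eq_right hx) hU
      ((hg.mono subset_closure).abs.sup continuousOn_const) continuousOn_const
  have h2 := h1.of_subset_closure (hg.abs.sup continuousOn_const) continuousOn_const
    subset_closure le_rfl
  exact fun x hx => max_eq_right_iff.1 (h2 hx)

theorem ofReal_abs_le_eLpNorm_top {s : Finset R3} (h : IsTet s) {u g : R3 → ℝ}
    (hg : ContinuousOn g (simplexHull s))
    (hgu : g =ᵐ[volume.restrict (interior (simplexHull s))] u) {x : R3} (hx : x ∈ simplexHull s) :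
    ENNReal.ofReal |g x| ≤ eLpNorm u ∞ (volume.restrict (simplexHull s)) := by
  rw [← restrict_interior_simplexHull, ← eLpNorm_congr_ae hgu]
  set c := eLpNorm g ∞ (volume.restrict (interior (simplexHull s))) with hc
  by_cases hct : c = ⊤
  · rw [hct]; exact le_top
  rw [ENNReal.ofReal_le_iff_le_toReal hct]
  refine abs_le_on_closure_of_ae isOpen_interior (by rwa [h.closure_interior]) ?_ x
    (by rwa [h.closure_interior])
  rw [eLpNorm_exponent_top] at hc
  filter_upwards [enorm_ae_le_eLpNormEssSup g (volume.restrict (interior (simplexHull s)))]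
    with y hy
  rw [← hc, Real.enorm_eq_ofReal_abs, ENNReal.ofReal_le_iff_le_toReal hct] at hy
  exact hy

theorem ae_norm_le_toNNReal_eLpNorm_top {μ : Measure R3} {G : R3 → R3} (h : eLpNorm G ∞ μ ≠ ⊤) :
    ∀ᵐ x ∂μ, ‖G x‖ ≤ (eLpNorm G ∞ μ).toNNReal := by
  filter_upwards [enorm_ae_le_eLpNormEssSup G μ] with x hx
  rw [eLpNorm_exponent_top] at h ⊢
  rw [← coe_nnnorm, NNReal.coe_le_coe]
  rwa [← ENNReal.coe_le_coe, ENNReal.coe_toNNReal h]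

/-- Each bounded weak gradient gives a Lipschitz representative, which by continuity is `g` on the
closed simplex. Dividing by the distance isolates the infimum over weak gradients. -/
theorem ofReal_abs_sub_le_gradLinfNorm {s : Finset R3} (h : IsTet s) {u g : R3 → ℝ}
    (hg : ContinuousOn g (simplexHull s))
    (hgu : g =ᵐ[volume.restrict (interior (simplexHull s))] u)
    (hu : IntegrableOn u (interior (simplexHull s))) {x y : R3} (hx : x ∈ simplexHull s)
    (hy : y ∈ simplexHull s) :
    ENNReal.ofReal |g x - g y| ≤
      gradLinfNorm (interior (simplexHull s)) u * ENNReal.ofReal ‖x - y‖ := by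
  rcases eq_or_ne x y with rfl | hxy
  · simp
  have hpos : 0 < ‖x - y‖ := norm_pos_iff.2 (sub_ne_zero.2 hxy)
  rw [← ENNReal.div_le_iff (ENNReal.ofReal_pos.2 hpos).ne' ENNReal.ofReal_ne_top]
  refine le_iInf₂ fun G hG => ?_
  by_cases htop : eLpNorm G ∞ (volume.restrict (interior (simplexHull s))) = ⊤
  · rw [htop]; exact le_top
  obtain ⟨f, hf, hfu⟩ := hG.exists_lipschitzWith isOpen_interior (convex_simplexHull s).interior hu
    (ae_norm_le_toNNReal_eLpNorm_top htop)
  have hfg : EqOn f g (simplexHull s) := by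
    have h1 := Measure.eqOn_open_of_ae_eq (hfu.trans hgu.symm) isOpen_interior
      hf.continuous.continuousOn (hg.mono interior_subset)
    exact h1.of_subset_closure hf.continuous.continuousOn hg interior_subset
      h.closure_interior.ge
  rw [ENNReal.div_le_iff (ENNReal.ofReal_pos.2 hpos).ne' ENNReal.ofReal_ne_top,
    ← hfg hx, ← hfg hy, ← Real.enorm_eq_ofReal_abs, ofReal_norm,
    ← edist_eq_enorm_sub, ← edist_eq_enorm_sub]
  refine (hf x y).trans (le_of_eq ?_)
  rw [ENNReal.coe_toNNReal htop]

/-! ### The interpolant on the mesh and the global Lipschitz representative -/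

namespace TetMesh

variable {Ω : Set R3} (T : TetMesh Ω)

theorem isTet {s : Finset R3} (hs : s ∈ T.elements) : IsTet s :=
  ⟨T.card_eq s hs, T.indep s hs⟩

theorem simplexHull_subset {s : Finset R3} (hs : s ∈ T.elements) :
    simplexHull s ⊆ closure Ω := by
  rw [← T.cover]
  exact subset_biUnion_of_mem (u := fun s => simplexHull s) hs

theorem interior_simplexHull_subset (hΩ : IsConvexPolyhedron Ω) {s : Finset R3}
    (hs : s ∈ T.elements) : interior (simplexHull s) ⊆ Ω := by
  rw [← hΩ.interior_closure]
  exact interior_mono (T.simplexHull_subset hs)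

theorem ae_restrict_of_forall_elements {p : R3 → Prop}
    (h : ∀ s ∈ T.elements, ∀ᵐ x ∂volume.restrict (interior (simplexHull s)), p x) :
    ∀ᵐ x ∂volume.restrict Ω, p x := by
  refine ae_restrict_of_ae_restrict_of_subset (t := ⋃ s ∈ T.elements, simplexHull s) ?_ ?_
  · rw [T.cover]; exact subset_closure
  · rw [ae_restrict_biUnion_finset_iff]
    intro s hs
    rw [← restrict_interior_simplexHull]
    exact h s hs

/-- Conformity puts any point of two elements on their common face, so the arbitrary choice of an
element is harmless; continuity follows from the finite closed cover. -/
theorem exists_eq_localInterp (k : ℕ) (g : R3 → ℝ) :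
    ∃ w, T.MemPkCont k w ∧ ∀ s ∈ T.elements, ∀ x ∈ simplexHull s, w x = localInterp k s g x := by
  classical
  let w : R3 → ℝ := fun x =>
    if h : ∃ s ∈ T.elements, x ∈ simplexHull s then localInterp k h.choose g x else 0
  have hw : ∀ s ∈ T.elements, ∀ x ∈ simplexHull s, w x = localInterp k s g x := by
    intro s hs x hx
    have h : ∃ s ∈ T.elements, x ∈ simplexHull s := ⟨s, hs, hx⟩
    simp only [w, dif_pos h]
    refine localInterp_eq_of_face (T.isTet h.choose_spec.1) (T.isTet hs) g ?_
    rw [← T.conforming _ h.choose_spec.1 _ hs]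
    exact ⟨h.choose_spec.2, hx⟩
  refine ⟨w, ⟨?_, fun s hs => ?_⟩, hw⟩
  · have hc : closure Ω = ⋃ s : T.elements, simplexHull s := by
      rw [← T.cover]
      exact (iUnion_subtype (fun s => s ∈ T.elements) fun s => simplexHull s.1).symm
    rw [hc]
    refine (locallyFinite_of_finite _).continuousOn_iUnion
      (fun s => (isCompact_simplexHull _).isClosed) fun s => ?_
    exact (contDiff_localInterp k s g).continuous.continuousOn.congr (hw s s.2)
  · obtain ⟨p, hp, hpe⟩ := isPolyOn_localInterp k s g (simplexHull s)
    exact ⟨p, hp, fun x hx => (hw s hs x hx).trans (hpe x hx)⟩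

/-- Two representatives continuous on the closure agree there, so the nodal values depend only on
the class of `u`; unisolvence then fixes the interpolant on each element. -/
theorem interpWellDefined_and_eq_localInterp {k : ℕ} (hk : 1 ≤ k) (hΩ : IsOpen Ω) {u g : R3 → ℝ}
    (hg : ContinuousOn g (closure Ω)) (hgu : g =ᵐ[volume.restrict Ω] u) :
    T.InterpWellDefined k u ∧ ∀ s ∈ T.elements, ∀ x ∈ simplexHull s,
      T.lagrangeInterp k u x = localInterp k s g x := by
  have huniq : ∀ w, T.IsLagrangeInterpolant k u w → ∀ s ∈ T.elements, ∀ x ∈ simplexHull s,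
      w x = localInterp k s g x := by
    rintro w ⟨hw, f, hf, hfu, hwf⟩ s hs
    have hfg : EqOn f g (closure Ω) :=
      (Measure.eqOn_open_of_ae_eq (hfu.trans hgu.symm) hΩ (hf.mono subset_closure)
        (hg.mono subset_closure)).of_subset_closure hf hg subset_closure le_rfl
    refine (hw.2 s hs).eq_localInterp hk (T.isTet hs) fun x hx => ?_
    rw [hwf s hs x hx]
    obtain ⟨α, hα, rfl⟩ := mem_lagrangeNodes_iff.1 hx
    exact hfg (T.simplexHull_subset hs
      (latticeNode_mem hk (T.isTet hs) (Finset.mem_piAntidiag.1 hα).1))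
  have hex : ∃ w, T.IsLagrangeInterpolant k u w := by
    obtain ⟨w, hw, hwe⟩ := T.exists_eq_localInterp k g
    refine ⟨w, hw, g, hg, hgu, fun s hs x hx => ?_⟩
    obtain ⟨α, hα, rfl⟩ := mem_lagrangeNodes_iff.1 hx
    rw [hwe s hs _ (latticeNode_mem hk (T.isTet hs) (Finset.mem_piAntidiag.1 hα).1),
      localInterp_latticeNode hk (T.isTet hs) g hα]
  have hspec : T.IsLagrangeInterpolant k u (T.lagrangeInterp k u) := by
    rw [lagrangeInterp, dif_pos hex]
    exact Classical.choose_spec hex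
  refine ⟨⟨hspec, fun w hw x hx => ?_⟩, huniq _ hspec⟩
  rw [← T.cover] at hx
  obtain ⟨s, hs, hxs⟩ := mem_iUnion₂.1 hx
  rw [huniq w hw s hs x hxs, huniq _ hspec s hs x hxs]

theorem exists_lipschitzWith_ae_eq (hΩ : IsConvexPolyhedron Ω) {ε : ℝ} (hε : 0 < ε) {u : R3 → ℝ}
    (hu : MemHs (3 / 2 + ε) Ω u) (huT : T.MemBrokenW1inf u) :
    ∃ (M : NNReal) (g : R3 → ℝ), LipschitzWith M g ∧ g =ᵐ[volume.restrict Ω] u := by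
  -- Order at least one yields a weak gradient on all of `Ω`, across the faces as well.
  have hfloor : 1 ≤ ⌊3 / 2 + ε⌋₊ := Nat.le_floor (by push_cast; linarith)
  choose g hg _ using fun i : Fin 3 => hu 1 hfloor fun _ => i
  let G : R3 → R3 := fun x => WithLp.toLp 2 fun i => g i x
  have hG : HasWeakGrad Ω u G := hg
  have hb : ∀ s ∈ T.elements, ∃ M : NNReal,
      ∀ᵐ x ∂volume.restrict (interior (simplexHull s)), ‖G x‖ ≤ M := by
    intro s hs
    have hlt : gradLinfNorm (interior (simplexHull s)) u < ⊤ :=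
      (le_max_right _ _).trans_lt (huT.2 s hs).2
    simp only [gradLinfNorm, iInf_lt_iff] at hlt
    obtain ⟨H, hH, hlt⟩ := hlt
    refine ⟨(eLpNorm H ∞ (volume.restrict (interior (simplexHull s)))).toNNReal, ?_⟩
    filter_upwards [ae_norm_le_toNNReal_eLpNorm_top hlt.ne,
      (hG.mono (T.interior_simplexHull_subset hΩ hs)).ae_eq isOpen_interior hH] with x hx hx'
    rwa [hx']
  choose! M hM using hb
  have hfin : IsFiniteMeasure ((volume : Measure R3).restrict Ω) :=
    isFiniteMeasure_restrict.2 hΩ.isBounded.measure_lt_top.ne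
  obtain ⟨f, hf, hfu⟩ := hG.exists_lipschitzWith hΩ.isOpen hΩ.convex
    -- The sum of the elementwise bounds dominates each of them. This constant serves only to obtain
    -- a continuous representative and enters no estimate.
    (huT.1.integrable (by norm_num)) (M := ∑ s ∈ T.elements, M s) (by
      refine T.ae_restrict_of_forall_elements fun s hs => ?_
      filter_upwards [hM s hs] with x hx
      refine hx.trans (NNReal.coe_le_coe.2 ?_)
      exact Finset.single_le_sum (f := M) (fun _ _ => zero_le) hs)
  exact ⟨_, f, hf, hfu⟩

end TetMesh

/-! ### Bounds for the basis functions and barycentric coordinates -/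

/-- Telescoping: exchange one factor at a time. `1 ≤ B` absorbs the unequal powers of `B`. -/
theorem abs_prod_sub_prod_le {ι : Type*} (s : Finset ι) {a b : ι → ℝ} {B d : ℝ} (hB : 1 ≤ B)
    (ha : ∀ i ∈ s, |a i| ≤ B) (hb : ∀ i ∈ s, |b i| ≤ B) (hd : ∀ i ∈ s, |a i - b i| ≤ d) :
    |∏ i ∈ s, a i - ∏ i ∈ s, b i| ≤ s.card * B ^ s.card * d := by
  classical
  induction s using Finset.induction_on with
  | empty => simp
  | insert j s hj ih =>
    have ih' := ih (fun i hi => ha i (Finset.mem_insert_of_mem hi))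
      (fun i hi => hb i (Finset.mem_insert_of_mem hi))
      (fun i hi => hd i (Finset.mem_insert_of_mem hi))
    have hdj := hd j (Finset.mem_insert_self j s)
    have haj := ha j (Finset.mem_insert_self j s)
    have hd0 : 0 ≤ d := (abs_nonneg _).trans hdj
    have hbs : |∏ i ∈ s, b i| ≤ B ^ s.card := by
      rw [Finset.abs_prod]
      exact (Finset.prod_le_prod (fun _ _ => abs_nonneg _)
        fun i hi => hb i (Finset.mem_insert_of_mem hi)).trans_eq (Finset.prod_const B)
    rw [Finset.prod_insert hj, Finset.prod_insert hj, Finset.card_insert_of_notMem hj]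
    have e : a j * ∏ i ∈ s, a i - b j * ∏ i ∈ s, b i =
        a j * (∏ i ∈ s, a i - ∏ i ∈ s, b i) + (a j - b j) * ∏ i ∈ s, b i := by ring
    rw [e]
    refine (abs_add_le _ _).trans ?_
    rw [abs_mul, abs_mul]
    have h1 := mul_le_mul haj ih' (abs_nonneg _) (by linarith)
    have h2 := mul_le_mul hdj hbs (abs_nonneg _) hd0
    have h3 : d * B ^ s.card ≤ d * B ^ (s.card + 1) :=
      mul_le_mul_of_nonneg_left (pow_le_pow_right₀ hB (Nat.le_succ _)) hd0
    push_cast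
    calc _ ≤ B * (s.card * B ^ s.card * d) + d * B ^ (s.card + 1) := by linarith
      _ = _ := by ring

theorem abs_factor_le {k j : ℕ} (hj : j ≤ k) {w : ℝ} (h0 : 0 ≤ w) (h1 : w ≤ 1) :
    |((k : ℝ) * w - j) / (j + 1)| ≤ k := by
  have hj' : (j : ℝ) ≤ k := by exact_mod_cast hj
  have hj0 : (0 : ℝ) ≤ j := Nat.cast_nonneg j
  have hk0 : (0 : ℝ) ≤ k := Nat.cast_nonneg k
  rw [abs_div, abs_of_pos (by positivity : (0 : ℝ) < j + 1), div_le_iff₀ (by positivity), abs_le]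
  constructor <;> nlinarith [mul_nonneg hk0 h0, mul_nonneg hk0 (sub_nonneg.2 h1),
    mul_nonneg hk0 hj0]

theorem lagrangeShape_eq_prod_sigma (k : ℕ) (s : Finset R3) (α : R3 → ℕ) (w : R3 → ℝ) :
    lagrangeShape k s α w = ∏ i ∈ s.sigma fun v => Finset.range (α v),
      ((k : ℝ) * w i.1 - i.2) / (i.2 + 1) :=
  Finset.prod_sigma' _ _ _

theorem card_sigma_range (s : Finset R3) (α : R3 → ℕ) :
    (s.sigma fun v => Finset.range (α v)).card = ∑ v ∈ s, α v := by
  simp [Finset.card_sigma]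

theorem le_of_mem_sigma_range {k : ℕ} {s : Finset R3} {α : R3 → ℕ} (hα : ∑ v ∈ s, α v = k)
    {i : (_ : R3) × ℕ} (hi : i ∈ s.sigma fun v => Finset.range (α v)) : i.1 ∈ s ∧ i.2 ≤ k := by
  rw [Finset.mem_sigma, Finset.mem_range] at hi
  refine ⟨hi.1, hi.2.le.trans ?_⟩
  rw [← hα]
  exact Finset.single_le_sum (f := α) (fun _ _ => Nat.zero_le _) hi.1

theorem abs_lagrangeShape_le {k : ℕ} {s : Finset R3} {α : R3 → ℕ} (hα : ∑ v ∈ s, α v = k)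
    {w : R3 → ℝ} (hw : ∀ v ∈ s, 0 ≤ w v ∧ w v ≤ 1) : |lagrangeShape k s α w| ≤ (k : ℝ) ^ k := by
  rw [lagrangeShape_eq_prod_sigma, Finset.abs_prod]
  refine (Finset.prod_le_prod (g := fun _ => (k : ℝ)) (fun _ _ => abs_nonneg _)
    fun i hi => ?_).trans_eq (by rw [Finset.prod_const, card_sigma_range, hα])
  obtain ⟨h1, h2⟩ := le_of_mem_sigma_range hα hi
  exact abs_factor_le h2 (hw _ h1).1 (hw _ h1).2

/-- There are `k` factors in all, each bounded by `k` and `k`-Lipschitz in its coordinate. -/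
theorem abs_lagrangeShape_sub_le {k : ℕ} (hk : 1 ≤ k) {s : Finset R3} {α : R3 → ℕ}
    (hα : ∑ v ∈ s, α v = k) {w w' : R3 → ℝ} (hw : ∀ v ∈ s, 0 ≤ w v ∧ w v ≤ 1)
    (hw' : ∀ v ∈ s, 0 ≤ w' v ∧ w' v ≤ 1) {δ : ℝ} (hδ : ∀ v ∈ s, |w v - w' v| ≤ δ) :
    |lagrangeShape k s α w - lagrangeShape k s α w'| ≤ k * (k : ℝ) ^ k * (k * δ) := by
  rw [lagrangeShape_eq_prod_sigma, lagrangeShape_eq_prod_sigma]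
  have := abs_prod_sub_prod_le (s.sigma fun v => Finset.range (α v)) (B := k) (d := k * δ)
    (a := fun i => ((k : ℝ) * w i.1 - i.2) / (i.2 + 1))
    (b := fun i => ((k : ℝ) * w' i.1 - i.2) / (i.2 + 1)) (by exact_mod_cast hk)
    (fun i hi => by
      obtain ⟨h1, h2⟩ := le_of_mem_sigma_range hα hi
      exact abs_factor_le h2 (hw _ h1).1 (hw _ h1).2)
    (fun i hi => by
      obtain ⟨h1, h2⟩ := le_of_mem_sigma_range hα hi
      exact abs_factor_le h2 (hw' _ h1).1 (hw' _ h1).2)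
    (fun i hi => by
      obtain ⟨h1, h2⟩ := le_of_mem_sigma_range hα hi
      have e : ((k : ℝ) * w i.1 - i.2) / (i.2 + 1) - ((k : ℝ) * w' i.1 - i.2) / (i.2 + 1) =
          k * (w i.1 - w' i.1) / (i.2 + 1) := by ring
      rw [e, abs_div, abs_mul, abs_of_nonneg (Nat.cast_nonneg k : (0 : ℝ) ≤ k)]
      refine (div_le_self (by positivity) ?_).trans
        (mul_le_mul_of_nonneg_left (hδ _ h1) (Nat.cast_nonneg k))
      rw [abs_of_pos (by positivity)]
      linarith [(Nat.cast_nonneg i.2 : (0 : ℝ) ≤ i.2)])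
  rwa [card_sigma_range, hα] at this

/-- An affine function with values in `[0, 1]` on a ball of radius `ρ` cannot be steep. -/
theorem abs_bary_sub_le {s : Finset R3} (h : IsTet s) {x₀ : R3} {ρ : ℝ} (hρ : 0 < ρ)
    (hball : Metric.ball x₀ ρ ⊆ simplexHull s) {v : R3} (hv : v ∈ s) (x y : R3) :
    |bary s v x - bary s v y| ≤ ‖x - y‖ / ρ := by
  rcases eq_or_ne x y with rfl | hxy
  · simp
  have hpos : 0 < ‖x - y‖ := norm_pos_iff.2 (sub_ne_zero.2 hxy)
  -- Scales `x - y` to length `ρ / 2`, strictly inside the open ball. The two antipodal points are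
  -- at distance `ρ` and the values there differ by at most `1`.
  set c : ℝ := ρ / (2 * ‖x - y‖) with hc
  have hc0 : 0 < c := by positivity
  have hcn : c * ‖x - y‖ = ρ / 2 := by rw [hc]; field_simp
  have hmem : ∀ z : R3, ‖z‖ = ρ / 2 → 0 ≤ bary s v (z + x₀) ∧ bary s v (z + x₀) ≤ 1 := by
    intro z hz
    have : z + x₀ ∈ simplexHull s := hball (by
      rw [Metric.mem_ball, dist_eq_norm, add_sub_cancel_right, hz]; linarith)
    exact ⟨(mem_simplexHull_iff h).1 this v hv, bary_le_one h this hv⟩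
  have h1 := hmem (c • (x - y)) (by rw [norm_smul, Real.norm_of_nonneg hc0.le, hcn])
  have h2 := hmem (-(c • (x - y)))
    (by rw [norm_neg, norm_smul, Real.norm_of_nonneg hc0.le, hcn])
  have hlin : ∀ z : R3, bary s v (z + x₀) = (bary s v).linear z + bary s v x₀ := fun z =>
    (bary s v).map_vadd x₀ z
  have hsub : bary s v x - bary s v y = (bary s v).linear (x - y) :=
    ((bary s v).linearMap_vsub x y).symm
  rw [hlin, map_smul, smul_eq_mul] at h1
  rw [hlin, map_neg, map_smul, smul_eq_mul] at h2
  rw [hsub, le_div_iff₀ hρ]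
  have hρc : ρ = 2 * c * ‖x - y‖ := by linarith
  have h3 : |(bary s v).linear (x - y)| * (2 * c) ≤ 1 := by
    rw [← abs_of_pos (by positivity : 0 < 2 * c), ← abs_mul, abs_le]
    constructor <;> nlinarith [h1.1, h1.2, h2.1, h2.2]
  rw [hρc]
  nlinarith

open Classical in
theorem card_piAntidiag_le (s : Finset R3) (k : ℕ) :
    (s.piAntidiag k).card ≤ (k + 1) ^ s.card := by
  have : (s.pi fun _ => Finset.range (k + 1)).card = (k + 1) ^ s.card := by
    simp [Finset.card_pi]
  rw [← this]
  refine Finset.card_le_card_of_injOn (fun α v _ => α v) (fun α hα => ?_) fun α hα β hβ hαβ => ?_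
  · simp only [Finset.mem_coe, Finset.mem_pi, Finset.mem_range] at hα ⊢
    intro v hv
    rw [Finset.mem_piAntidiag] at hα
    rw [Nat.lt_succ_iff, ← hα.1]
    exact Finset.single_le_sum (f := α) (fun _ _ => Nat.zero_le _) hv
  · rw [Finset.mem_coe, Finset.mem_piAntidiag] at hα hβ
    funext v
    by_cases hv : v ∈ s
    · exact congrFun (congrFun hαβ v) hv
    · rw [not_imp_comm.1 (hα.2 v) hv, not_imp_comm.1 (hβ.2 v) hv]

/-- A bound for the Lebesgue constant of the principal lattice of order `k`. -/
def lebesgueConst (k : ℕ) : ℝ := (k + 1) ^ 4 * (k : ℝ) ^ k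

/-- A bound for the Lipschitz constant of interpolation with respect to barycentric coordinates. -/
def lagrangeLipConst (k : ℕ) : ℝ := (k + 1) ^ 4 * (k * (k : ℝ) ^ k * k)

theorem lebesgueConst_nonneg (k : ℕ) : 0 ≤ lebesgueConst k := by
  unfold lebesgueConst; positivity

theorem lagrangeLipConst_nonneg (k : ℕ) : 0 ≤ lagrangeLipConst k := by
  unfold lagrangeLipConst; positivity

theorem bary_mem_unit {s : Finset R3} (h : IsTet s) {x : R3} (hx : x ∈ simplexHull s) :
    ∀ v ∈ s, 0 ≤ bary s v x ∧ bary s v x ≤ 1 :=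
  fun v hv => ⟨(mem_simplexHull_iff h).1 hx v hv, bary_le_one h hx hv⟩

open Classical in
theorem sum_piAntidiag_le {s : Finset R3} (h : IsTet s) {k : ℕ} {f : (R3 → ℕ) → ℝ} {c : ℝ}
    (hc : 0 ≤ c) (hf : ∀ α ∈ s.piAntidiag k, |f α| ≤ c) :
    |∑ α ∈ s.piAntidiag k, f α| ≤ (k + 1) ^ 4 * c := by
  refine (Finset.abs_sum_le_sum_abs _ _).trans ((Finset.sum_le_card_nsmul _ _ c hf).trans ?_)
  rw [nsmul_eq_mul]
  refine mul_le_mul_of_nonneg_right ?_ hc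
  have := card_piAntidiag_le s k
  rw [h.1] at this
  exact_mod_cast this

/-! ### Stability and superapproximation on one element -/

section Element

variable {k : ℕ} {s : Finset R3}

theorem abs_localInterp_le (hk : 1 ≤ k) (h : IsTet s) {g : R3 → ℝ} {m : ℝ} (hm : 0 ≤ m)
    (hg : ∀ x ∈ simplexHull s, |g x| ≤ m) {x : R3} (hx : x ∈ simplexHull s) :
    |localInterp k s g x| ≤ lebesgueConst k * m := by
  refine (sum_piAntidiag_le h (c := m * (k : ℝ) ^ k) (by positivity) fun α hα => ?_).trans
    (le_of_eq (by rw [lebesgueConst]; ring))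
  have hα' := (Finset.mem_piAntidiag.1 hα).1
  rw [abs_mul]
  exact mul_le_mul (hg _ (latticeNode_mem hk h hα')) (abs_lagrangeShape_le hα' (bary_mem_unit h hx))
    (abs_nonneg _) hm

theorem localInterp_sub (g f : R3 → ℝ) (x : R3) :
    localInterp k s (g - f) x = localInterp k s g x - localInterp k s f x := by
  simp only [localInterp, Pi.sub_apply, sub_mul, Finset.sum_sub_distrib]

theorem localInterp_const_mul_of_isPolyOn (hk : 1 ≤ k) (h : IsTet s) {v : R3 → ℝ}
    (hv : IsPolyOn k (simplexHull s) v) (c : ℝ) {x : R3} (hx : x ∈ simplexHull s) :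
    localInterp k s (fun y => c * v y) x = c * v x := by
  have h1 : localInterp k s (fun y => c * v y) x = c * localInterp k s v x := by
    simp only [localInterp, Finset.mul_sum, mul_assoc]
  rw [h1, ← hv.eq_localInterp hk h (fun _ _ => rfl) x hx]

theorem localInterp_const (hk : 1 ≤ k) (h : IsTet s) (c : ℝ) {x : R3} (hx : x ∈ simplexHull s) :
    localInterp k s (fun _ => c) x = c := by
  have : IsPolyOn k (simplexHull s) fun _ => 1 := ⟨1, by simp, fun x _ => by simp⟩
  simpa using localInterp_const_mul_of_isPolyOn hk h this c hx

/-- Constants are reproduced, so subtracting `c` leaves increments unchanged and only the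
oscillation of `g` counts. -/
theorem abs_localInterp_sub_le_of_center (hk : 1 ≤ k) (h : IsTet s) {x₀ : R3} {ρ : ℝ} (hρ : 0 < ρ)
    (hball : Metric.ball x₀ ρ ⊆ simplexHull s) {g : R3 → ℝ} {c m : ℝ} (hm : 0 ≤ m)
    (hg : ∀ x ∈ simplexHull s, |g x - c| ≤ m) {x y : R3} (hx : x ∈ simplexHull s)
    (hy : y ∈ simplexHull s) :
    |localInterp k s g x - localInterp k s g y| ≤ lagrangeLipConst k * (m / ρ) * ‖x - y‖ := by
  have e : localInterp k s g x - localInterp k s g y =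
      localInterp k s (g - fun _ => c) x - localInterp k s (g - fun _ => c) y := by
    rw [localInterp_sub, localInterp_sub, localInterp_const hk h c hx, localInterp_const hk h c hy]
    ring
  rw [e, localInterp, localInterp, ← Finset.sum_sub_distrib]
  refine (sum_piAntidiag_le h (c := m * (k * (k : ℝ) ^ k * (k * (‖x - y‖ / ρ))))
    (by positivity) fun α hα => ?_).trans (le_of_eq (by rw [lagrangeLipConst]; ring))
  have hα' := (Finset.mem_piAntidiag.1 hα).1
  rw [← mul_sub, abs_mul]
  exact mul_le_mul (hg _ (latticeNode_mem hk h hα')) (abs_lagrangeShape_sub_le hk hα'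
    (bary_mem_unit h hx) (bary_mem_unit h hy) fun v hv => abs_bary_sub_le h hρ hball hv x y)
    (abs_nonneg _) hm

theorem norm_sub_le_simplexDiam {x y : R3} (hx : x ∈ simplexHull s) (hy : y ∈ simplexHull s) :
    ‖x - y‖ ≤ simplexDiam s := by
  rw [← dist_eq_norm]
  exact Metric.dist_le_diam_of_mem (isCompact_simplexHull s).isBounded hx hy

theorem IsTet.simplexDiam_pos (h : IsTet s) : 0 < simplexDiam s := by
  obtain ⟨a, ha, b, hb, hab⟩ := Finset.one_lt_card.1 (by rw [h.1]; norm_num : 1 < s.card)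
  exact (norm_pos_iff.2 (sub_ne_zero.2 hab)).trans_le
    (norm_sub_le_simplexDiam (subset_simplexHull ha) (subset_simplexHull hb))

variable {g : R3 → ℝ} {L : ℝ}

theorem abs_sub_le_mul_simplexDiam (hL : 0 ≤ L)
    (hg : ∀ x ∈ simplexHull s, ∀ y ∈ simplexHull s, |g x - g y| ≤ L * ‖x - y‖) {x y : R3}
    (hx : x ∈ simplexHull s) (hy : y ∈ simplexHull s) : |g x - g y| ≤ L * simplexDiam s :=
  (hg x hx y hy).trans (mul_le_mul_of_nonneg_left (norm_sub_le_simplexDiam hx hy) hL)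

/-- The oscillation of `g` is at most `L h`, while the basis functions vary at rate `1 / ρ`; shape
regularity bounds the quotient `h / ρ`. -/
theorem abs_localInterp_sub_le (hk : 1 ≤ k) (h : IsTet s) {x₀ : R3} {ρ cM : ℝ} (hρ : 0 < ρ)
    (hball : Metric.ball x₀ ρ ⊆ simplexHull s) (hreg : simplexDiam s ≤ cM * ρ) (hL : 0 ≤ L)
    (hg : ∀ x ∈ simplexHull s, ∀ y ∈ simplexHull s, |g x - g y| ≤ L * ‖x - y‖) {x y : R3}
    (hx : x ∈ simplexHull s) (hy : y ∈ simplexHull s) :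
    |localInterp k s g x - localInterp k s g y| ≤ lagrangeLipConst k * cM * L * ‖x - y‖ := by
  refine (abs_localInterp_sub_le_of_center hk h hρ hball (c := g x)
    (mul_nonneg hL h.simplexDiam_pos.le)
    (fun z hz => abs_sub_le_mul_simplexDiam hL hg hz hx) hx hy).trans ?_
  refine mul_le_mul_of_nonneg_right ?_ (norm_nonneg _)
  rw [mul_assoc]
  refine mul_le_mul_of_nonneg_left ?_ (lagrangeLipConst_nonneg k)
  rw [div_le_iff₀ hρ]
  nlinarith

theorem localInterp_mul_eq (hk : 1 ≤ k) (h : IsTet s) {v : R3 → ℝ}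
    (hv : IsPolyOn k (simplexHull s) v) (c : ℝ) {x : R3} (hx : x ∈ simplexHull s) :
    localInterp k s (g * v) x = localInterp k s (fun y => (g y - c) * v y) x + c * v x := by
  rw [← localInterp_const_mul_of_isPolyOn hk h hv c hx, ← sub_eq_iff_eq_add, ← localInterp_sub]
  congr 1
  funext y
  simp only [Pi.sub_apply, Pi.mul_apply]
  ring

/-- With the coefficient frozen at the evaluation point `x`, the terms `g x * v x` cancel and only
the interpolant of `(g - g x) v`, which is of size `L h V`, remains. -/
theorem abs_mul_sub_localInterp_le (hk : 1 ≤ k) (h : IsTet s) (hL : 0 ≤ L)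
    (hg : ∀ x ∈ simplexHull s, ∀ y ∈ simplexHull s, |g x - g y| ≤ L * ‖x - y‖) {v : R3 → ℝ}
    (hv : IsPolyOn k (simplexHull s) v) {V : ℝ} (hV : ∀ x ∈ simplexHull s, |v x| ≤ V) {x : R3}
    (hx : x ∈ simplexHull s) :
    |g x * v x - localInterp k s (g * v) x| ≤ lebesgueConst k * (L * simplexDiam s * V) := by
  have hV0 : 0 ≤ V := (abs_nonneg _).trans (hV x hx)
  have hm : 0 ≤ L * simplexDiam s := mul_nonneg hL h.simplexDiam_pos.le
  rw [localInterp_mul_eq hk h hv (g x) hx, sub_add_cancel_right, abs_neg]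
  refine abs_localInterp_le hk h (by positivity) (fun y hy => ?_) hx
  rw [abs_mul]
  exact mul_le_mul (abs_sub_le_mul_simplexDiam hL hg hy hx) (hV y hy) (abs_nonneg _) hm

theorem abs_sub_localInterp_le (hk : 1 ≤ k) (h : IsTet s) (hL : 0 ≤ L)
    (hg : ∀ x ∈ simplexHull s, ∀ y ∈ simplexHull s, |g x - g y| ≤ L * ‖x - y‖) {x : R3}
    (hx : x ∈ simplexHull s) :
    |g x - localInterp k s g x| ≤ lebesgueConst k * (L * simplexDiam s) := by
  have h1 : IsPolyOn k (simplexHull s) (1 : R3 → ℝ) := ⟨1, by simp, fun x _ => by simp⟩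
  have := abs_mul_sub_localInterp_le hk h hL hg h1 (V := 1) (fun x _ => by simp) hx
  simpa using this

theorem abs_localInterp_mul_sub_le (hk : 1 ≤ k) (h : IsTet s) (hL : 0 ≤ L)
    (hg : ∀ x ∈ simplexHull s, ∀ y ∈ simplexHull s, |g x - g y| ≤ L * ‖x - y‖) {v : R3 → ℝ}
    (hv : IsPolyOn k (simplexHull s) v) {V : ℝ} (hV : ∀ x ∈ simplexHull s, |v x| ≤ V) {x : R3}
    (hx : x ∈ simplexHull s) :
    |localInterp k s (g * v) x - localInterp k s g x * v x| ≤
      2 * lebesgueConst k * (L * simplexDiam s * V) := by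
  have hm : 0 ≤ lebesgueConst k * (L * simplexDiam s) :=
    mul_nonneg (lebesgueConst_nonneg k) (mul_nonneg hL h.simplexDiam_pos.le)
  have e : localInterp k s (g * v) x - localInterp k s g x * v x =
      -(g x * v x - localInterp k s (g * v) x) + (g x - localInterp k s g x) * v x := by ring
  rw [e]
  refine (abs_add_le _ _).trans ?_
  rw [abs_neg, abs_mul]
  have h1 := abs_mul_sub_localInterp_le hk h hL hg hv hV hx
  have h2 := mul_le_mul (abs_sub_localInterp_le hk h hL hg hx) (hV x hx) (abs_nonneg _) hm
  linarith

end Element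

/-! ### From pointwise bounds to norms, and summation over the mesh -/

theorem exists_hasWeakGrad_of_eq_localInterp {k : ℕ} {s : Finset R3} {g w : R3 → ℝ}
    (hw : ∀ x ∈ simplexHull s, w x = localInterp k s g x) {K : ℝ}
    (hK : ∀ x ∈ simplexHull s, ∀ y ∈ simplexHull s,
      |localInterp k s g x - localInterp k s g y| ≤ K * ‖x - y‖) (hK0 : 0 ≤ K) :
    ∃ H : R3 → R3, HasWeakGrad (interior (simplexHull s)) w H ∧
      eLpNorm H ∞ (volume.restrict (interior (simplexHull s))) ≤ ENNReal.ofReal K := by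
  refine ⟨gradient (localInterp k s g), ((contDiff_localInterp k s g).hasWeakGrad _).congr
    isOpen_interior fun x hx => (hw x (interior_subset hx)).symm, ?_⟩
  rw [eLpNorm_exponent_top]
  refine eLpNormEssSup_le_of_ae_bound (ae_restrict_of_forall_mem
    isOpen_interior.measurableSet fun x hx => ?_)
  rw [gradient, LinearIsometryEquiv.norm_map]
  have hlip : LipschitzOnWith K.toNNReal (localInterp k s g) (simplexHull s) :=
    LipschitzOnWith.of_dist_le_mul fun x hx y hy => by
      rw [Real.dist_eq, dist_eq_norm, Real.coe_toNNReal K hK0]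
      exact hK x hx y hy
  have := norm_fderiv_le_of_lipschitzOn ℝ (mem_interior_iff_mem_nhds.1 hx) hlip
  rwa [Real.coe_toNNReal K hK0] at this

theorem gradLinfNorm_sub_le {U : Set R3} {u w : R3 → ℝ} {H : R3 → R3} (hH : HasWeakGrad U w H) :
    gradLinfNorm U (u - w) ≤ gradLinfNorm U u + eLpNorm H ∞ (volume.restrict U) := by
  -- Truncated subtraction leaves the infimum over weak gradients of `u` alone on the right.
  rw [← tsub_le_iff_right]
  refine le_iInf₂ fun G hG => ?_
  rw [tsub_le_iff_right]
  refine (iInf₂_le _ (hG.sub hH)).trans ?_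
  simp only [eLpNorm_exponent_top]
  have := eLpNormEssSup_add_le (f := G) (g := -H) (μ := volume.restrict U)
  rw [← eLpNorm_exponent_top (f := -H), eLpNorm_neg, eLpNorm_exponent_top,
    ← sub_eq_add_neg] at this
  exact this

theorem gradLinfNorm_le {U : Set R3} {w : R3 → ℝ} {H : R3 → R3} (hH : HasWeakGrad U w H) :
    gradLinfNorm U w ≤ eLpNorm H ∞ (volume.restrict U) :=
  iInf₂_le _ hH

/-- An `L²` estimate on an element from a pointwise estimate by the maximum of a polynomial. -/
theorem eLpNorm_sq_le_of_forall_bound {k : ℕ} {s : Finset R3} (h : IsTet s) {v f : R3 → ℝ}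
    (hvc : ContinuousOn v (simplexHull s)) (hv : IsPolyOn k (simplexHull s) v) {K : ℝ}
    (hf : ∀ V : ℝ, (∀ x ∈ simplexHull s, |v x| ≤ V) →
      ∀ᵐ x ∂volume.restrict (simplexHull s), |f x| ≤ K * (simplexDiam s * V)) :
    ENNReal.ofReal ((simplexDiam s)⁻¹ ^ 2) * eLpNorm f 2 (volume.restrict (simplexHull s)) ^ 2 ≤
      ENNReal.ofReal (K ^ 2 * inverseConst k) *
        eLpNorm v 2 (volume.restrict (simplexHull s)) ^ 2 := by
  -- The best admissible `V` is the attained maximum `|v x₀|`, to which the inverse estimate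
  -- applies.
  obtain ⟨x₀, hx₀, hmax⟩ := (isCompact_simplexHull s).exists_isMaxOn
    (h.interior_nonempty.mono interior_subset) hvc.abs
  have hb := hf |v x₀| fun x hx => hmax hx
  have hd := h.simplexDiam_pos
  have h1 : eLpNorm f 2 (volume.restrict (simplexHull s)) ^ 2 ≤
      ENNReal.ofReal (K ^ 2 * simplexDiam s ^ 2 * v x₀ ^ 2) * volume (simplexHull s) := by
    rw [eLpNorm_two_sq_eq_lintegral, ← setLIntegral_const]
    refine lintegral_mono_ae (hb.mono fun x hx => ENNReal.ofReal_le_ofReal ?_)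
    rw [← sq_abs (f x), ← sq_abs (v x₀)]
    refine (pow_le_pow_left₀ (abs_nonneg _) hx 2).trans (le_of_eq (by ring))
  calc _ ≤ ENNReal.ofReal ((simplexDiam s)⁻¹ ^ 2) *
        (ENNReal.ofReal (K ^ 2 * simplexDiam s ^ 2 * v x₀ ^ 2) * volume (simplexHull s)) := by
        gcongr
    _ = ENNReal.ofReal (K ^ 2) * (ENNReal.ofReal (v x₀ ^ 2) * volume (simplexHull s)) := by
        rw [← mul_assoc, ← mul_assoc, ← ENNReal.ofReal_mul (by positivity),
          ← ENNReal.ofReal_mul (by positivity)]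
        congr 2
        field_simp
    _ ≤ ENNReal.ofReal (K ^ 2) * (ENNReal.ofReal (inverseConst k) *
          eLpNorm v 2 (volume.restrict (simplexHull s)) ^ 2) := by
        refine mul_le_mul_right ?_ _
        exact hv.sq_mul_volume_le (convex_simplexHull s) (measurableSet_simplexHull s) hx₀
    _ = _ := by rw [← mul_assoc, ← ENNReal.ofReal_mul (by positivity)]

namespace TetMesh

variable {Ω : Set R3} (T : TetMesh Ω)

/-- If the interiors met, the common vertices would affinely span the space. A vertex of `s` outside
`t` would then lie in the span of the other vertices of `s`, against affine independence. -/
theorem disjoint_interior {s t : Finset R3} (hs : s ∈ T.elements) (ht : t ∈ T.elements)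
    (hst : s ≠ t) : Disjoint (interior (simplexHull s)) (interior (simplexHull t)) := by
  rw [disjoint_iff_inter_eq_empty, ← interior_inter, T.conforming s hs t ht]
  by_contra hne
  rw [← ne_eq, ← nonempty_iff_ne_empty,
    interior_convexHull_nonempty_iff_affineSpan_eq_top] at hne
  have : ¬s ⊆ t := fun h => hst (Finset.eq_of_subset_of_card_le h
    (by rw [T.card_eq s hs, T.card_eq t ht]))
  obtain ⟨v, hv, hvt⟩ := Finset.not_subset.1 this
  refine (T.indep s hs).notMem_affineSpan_sdiff ⟨v, hv⟩ univ ?_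
  refine affineSpan_mono ℝ ?_ (hne ▸ AffineSubspace.mem_top ℝ R3 v)
  rintro x ⟨hxs, hxt⟩
  exact ⟨⟨x, hxs⟩, ⟨mem_univ _, fun hc => hvt (by
    have : x = v := congrArg Subtype.val hc
    rwa [← this])⟩, rfl⟩

theorem sum_eLpNorm_sq_le (hΩ : IsConvexPolyhedron Ω) (v : R3 → ℝ) :
    ∑ s ∈ T.elements, eLpNorm v 2 (volume.restrict (simplexHull s)) ^ 2 ≤
      eLpNorm v 2 (volume.restrict Ω) ^ 2 := by
  simp only [eLpNorm_two_sq_eq_lintegral, ← restrict_interior_simplexHull]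
  rw [← lintegral_biUnion_finset]
  · exact lintegral_mono_set (iUnion₂_subset fun s hs => T.interior_simplexHull_subset hΩ hs)
  · exact fun s hs t ht hst => T.disjoint_interior hs ht hst
  · exact fun s _ => isOpen_interior.measurableSet

theorem weightedL2Sq_le (hΩ : IsConvexPolyhedron Ω) {f v : R3 → ℝ} {c : ℝ≥0∞}
    (h : ∀ s ∈ T.elements, ENNReal.ofReal ((simplexDiam s)⁻¹ ^ 2) *
      eLpNorm f 2 (volume.restrict (simplexHull s)) ^ 2 ≤
        c * eLpNorm v 2 (volume.restrict (simplexHull s)) ^ 2) :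
    T.weightedL2Sq f ≤ c * eLpNorm v 2 (volume.restrict Ω) ^ 2 :=
  (Finset.sum_le_sum h).trans (by
    rw [← Finset.mul_sum]
    exact mul_le_mul_right (T.sum_eLpNorm_sq_le hΩ v) c)

end TetMesh

end

/-! ### Assembly of the main theorem -/

theorem mainTheorem7 (k : ℕ) (hk : 1 ≤ k) (cM : ℝ) (hcM : 0 < cM) :
    ∃ cL C : ℝ, 0 < cL ∧ 0 < C ∧
      ∀ (Ω : Set R3), IsConvexPolyhedron Ω →
      ∀ (T : TetMesh Ω), T.ShapeRegular cM →
      ∀ (ε : ℝ), 0 < ε →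
      ∀ (u : R3 → ℝ), MemHs (3 / 2 + ε) Ω u → T.MemBrokenW1inf u →
        T.InterpWellDefined k u ∧
        (∀ S : Finset (Finset R3), S ⊆ T.elements →
          eLpNorm (T.lagrangeInterp k u) ∞ (volume.restrict (⋃ s ∈ S, simplexHull s)) ≤
              ENNReal.ofReal cL * eLpNorm u ∞ (volume.restrict (⋃ s ∈ S, simplexHull s)) ∧
          TetMesh.brokenW1infNorm S (T.lagrangeInterp k u) ≤
              ENNReal.ofReal cL * TetMesh.brokenW1infNorm S u) ∧
        (∀ s ∈ T.elements,
          eLpNorm (u - T.lagrangeInterp k u) ∞ (volume.restrict (simplexHull s)) +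
              ENNReal.ofReal (simplexDiam s) *
                gradLinfNorm (interior (simplexHull s)) (u - T.lagrangeInterp k u) ≤
            ENNReal.ofReal C * ENNReal.ofReal (simplexDiam s) *
              w1infNorm (interior (simplexHull s)) u) ∧
        (∀ v : R3 → ℝ, T.MemPkCont k v →
          T.InterpWellDefined k (u * v) ∧
          T.weightedL2Sq (u * v - T.lagrangeInterp k (u * v)) ≤
              ENNReal.ofReal C * TetMesh.brokenW1infNorm T.elements u ^ 2 *
                eLpNorm v 2 (volume.restrict Ω) ^ 2 ∧
          T.weightedL2Sq (T.lagrangeInterp k (u * v) - T.lagrangeInterp k u * v) ≤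
              ENNReal.ofReal C * TetMesh.brokenW1infNorm T.elements u ^ 2 *
                eLpNorm v 2 (volume.restrict Ω) ^ 2) := by
  have hΛ := lebesgueConst_nonneg k
  have hD := lagrangeLipConst_nonneg k
  have hI := inverseConst_nonneg k
  set Λ := lebesgueConst k
  set D := lagrangeLipConst k * cM
  have hD0 : 0 ≤ D := mul_nonneg hD hcM.le
  -- `Λ` bounds values and `D` gradients of the interpolant; `1` accounts for `∇u` itself in the
  -- error and keeps `cL` positive. The last summand of `C` is the squared factor of the product
  -- estimates times the inverse constant.
  refine ⟨1 + Λ + D, 1 + Λ + D + (2 * Λ) ^ 2 * inverseConst k, by positivity, by positivity, ?_⟩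
  intro Ω hΩ T hreg ε hε u hu huT
  obtain ⟨M₀, g, hglip, hgu⟩ := T.exists_lipschitzWith_ae_eq hΩ hε hu huT
  have hgc : Continuous g := hglip.continuous
  obtain ⟨hwd, hloc⟩ :=
    T.interpWellDefined_and_eq_localInterp hk hΩ.isOpen hgc.continuousOn hgu
  have hgus : ∀ s ∈ T.elements, g =ᵐ[volume.restrict (interior (simplexHull s))] u :=
    fun s hs => ae_restrict_of_ae_restrict_of_subset (T.interior_simplexHull_subset hΩ hs) hgu
  have hguc : ∀ s ∈ T.elements, g =ᵐ[volume.restrict (simplexHull s)] u := fun s hs => by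
    rw [← restrict_interior_simplexHull]; exact hgus s hs
  have hfin : IsFiniteMeasure ((volume : Measure R3).restrict Ω) :=
    isFiniteMeasure_restrict.2 hΩ.isBounded.measure_lt_top.ne
  have huΩ : IntegrableOn u Ω := huT.1.integrable (by norm_num)
  have hgradfin : ∀ s ∈ T.elements, gradLinfNorm (interior (simplexHull s)) u ≠ ⊤ :=
    fun s hs => ((le_max_right _ _).trans_lt (huT.2 s hs).2).ne
  set L : Finset R3 → ℝ := fun s => (gradLinfNorm (interior (simplexHull s)) u).toReal
  have hL0 : ∀ s, 0 ≤ L s := fun s => ENNReal.toReal_nonneg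
  have hLe : ∀ s ∈ T.elements, ENNReal.ofReal (L s) = gradLinfNorm (interior (simplexHull s)) u :=
    fun s hs => ENNReal.ofReal_toReal (hgradfin s hs)
  have hgL : ∀ s ∈ T.elements, ∀ x ∈ simplexHull s, ∀ y ∈ simplexHull s,
      |g x - g y| ≤ L s * ‖x - y‖ := by
    intro s hs x hx y hy
    have := ofReal_abs_sub_le_gradLinfNorm (T.isTet hs) hgc.continuousOn (hgus s hs)
      (huΩ.mono_set (T.interior_simplexHull_subset hΩ hs)) hx hy
    rw [← hLe s hs, ← ENNReal.ofReal_mul (hL0 s)] at this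
    exact (ENNReal.ofReal_le_ofReal_iff (mul_nonneg (hL0 s) (norm_nonneg _))).1 this
  have hIL : ∀ s ∈ T.elements, ∃ H : R3 → R3,
      HasWeakGrad (interior (simplexHull s)) (T.lagrangeInterp k u) H ∧
      eLpNorm H ∞ (volume.restrict (interior (simplexHull s))) ≤ ENNReal.ofReal (D * L s) := by
    intro s hs
    obtain ⟨x₀, ρ, hρ, hdiam, hball, -⟩ := hreg s hs
    exact exists_hasWeakGrad_of_eq_localInterp (hloc s hs) (fun x hx y hy =>
      abs_localInterp_sub_le hk (T.isTet hs) hρ hball hdiam (hL0 s) (hgL s hs) hx hy)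
      (mul_nonneg hD0 (hL0 s))
  have hLinf : ∀ S : Finset (Finset R3), S ⊆ T.elements →
      eLpNorm (T.lagrangeInterp k u) ∞ (volume.restrict (⋃ s ∈ S, simplexHull s)) ≤
        ENNReal.ofReal (1 + Λ + D) *
          eLpNorm u ∞ (volume.restrict (⋃ s ∈ S, simplexHull s)) := by
    intro S hS
    set m := eLpNorm u ∞ (volume.restrict (⋃ s ∈ S, simplexHull s)) with hm
    by_cases hmt : m = ⊤
    -- Positivity of `cL` makes the right-hand side infinite here.
    · rw [hmt, ENNReal.mul_top (ENNReal.ofReal_pos.2 (by positivity)).ne']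
      exact le_top
    rw [← ENNReal.ofReal_toReal hmt, ← ENNReal.ofReal_mul (by positivity), eLpNorm_exponent_top]
    refine eLpNormEssSup_le_of_ae_bound (ae_restrict_of_forall_mem
      (S.measurableSet_biUnion fun s _ => measurableSet_simplexHull s) fun x hx => ?_)
    obtain ⟨s, hsS, hxs⟩ := mem_iUnion₂.1 hx
    have hs := hS hsS
    rw [hloc s hs x hxs, Real.norm_eq_abs]
    refine (abs_localInterp_le hk (T.isTet hs) (m := m.toReal) ENNReal.toReal_nonneg
      (fun y hy => ?_) hxs).trans
        (mul_le_mul_of_nonneg_right (by linarith) ENNReal.toReal_nonneg)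
    rw [← ENNReal.ofReal_le_iff_le_toReal hmt]
    refine (ofReal_abs_le_eLpNorm_top (T.isTet hs) hgc.continuousOn (hgus s hs) hy).trans ?_
    exact eLpNorm_mono_measure _ (Measure.restrict_mono_set _
      (subset_biUnion_of_mem (u := fun s => simplexHull s) hsS))
  refine ⟨hwd, fun S hS => ⟨hLinf S hS, ?_⟩, fun s hs => ?_, fun v hv => ?_⟩
  · refine Finset.sup_le fun s hsS => ?_
    have hs := hS hsS
    refine le_trans ?_ (mul_le_mul_right
      (Finset.le_sup (f := fun s => w1infNorm (interior (simplexHull s)) u) hsS) _)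
    refine max_le ?_ ?_
    · have := hLinf {s} (Finset.singleton_subset_iff.2 hs)
      simp only [Finset.mem_singleton, iUnion_iUnion_eq_left] at this
      rw [restrict_interior_simplexHull]
      refine this.trans (mul_le_mul_right ?_ _)
      rw [w1infNorm, restrict_interior_simplexHull]
      exact le_max_left _ _
    · obtain ⟨H, hH, hHn⟩ := hIL s hs
      refine ((gradLinfNorm_le hH).trans hHn).trans ?_
      rw [ENNReal.ofReal_mul hD0, hLe s hs]
      exact mul_le_mul' (ENNReal.ofReal_le_ofReal (by linarith)) (le_max_right _ _)
  · have hd := (T.isTet hs).simplexDiam_pos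
    have h1 : eLpNorm (u - T.lagrangeInterp k u) ∞ (volume.restrict (simplexHull s)) ≤
        ENNReal.ofReal (Λ * (L s * simplexDiam s)) := by
      rw [eLpNorm_exponent_top]
      refine eLpNormEssSup_le_of_ae_bound ?_
      filter_upwards [hguc s hs, ae_restrict_mem (measurableSet_simplexHull s)] with x hx hxs
      rw [Pi.sub_apply, ← hx, hloc s hs x hxs, Real.norm_eq_abs]
      exact abs_sub_localInterp_le hk (T.isTet hs) (hL0 s) (hgL s hs) hxs
    have h2 : gradLinfNorm (interior (simplexHull s)) (u - T.lagrangeInterp k u) ≤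
        ENNReal.ofReal (L s + D * L s) := by
      obtain ⟨H, hH, hHn⟩ := hIL s hs
      refine (gradLinfNorm_sub_le hH).trans ?_
      rw [ENNReal.ofReal_add (hL0 s) (mul_nonneg hD0 (hL0 s)), hLe s hs]
      gcongr
    have hLs := hL0 s
    calc _ ≤ ENNReal.ofReal (Λ * (L s * simplexDiam s)) +
          ENNReal.ofReal (simplexDiam s) * ENNReal.ofReal (L s + D * L s) := by gcongr
      _ = ENNReal.ofReal ((1 + Λ + D) * simplexDiam s) * ENNReal.ofReal (L s) := by
          rw [← ENNReal.ofReal_mul hd.le, ← ENNReal.ofReal_add (by positivity) (by positivity),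
            ← ENNReal.ofReal_mul (by positivity)]
          congr 1
          ring
      _ ≤ _ := by
          rw [← ENNReal.ofReal_mul (q := simplexDiam s) (by positivity), hLe s hs]
          refine mul_le_mul' (ENNReal.ofReal_le_ofReal ?_) (le_max_right _ _)
          refine mul_le_mul_of_nonneg_right ?_ hd.le
          linarith [mul_nonneg (sq_nonneg (2 * Λ)) hI]
  · have hguv : g * v =ᵐ[volume.restrict Ω] u * v := hgu.mul Filter.EventuallyEq.rfl
    obtain ⟨hwd', hloc'⟩ := T.interpWellDefined_and_eq_localInterp hk hΩ.isOpen
      (hgc.continuousOn.mul hv.1) hguv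
    have hle : ∀ s ∈ T.elements,
        ENNReal.ofReal ((2 * Λ * L s) ^ 2 * inverseConst k) ≤
          ENNReal.ofReal (1 + Λ + D + (2 * Λ) ^ 2 * inverseConst k) *
            TetMesh.brokenW1infNorm T.elements u ^ 2 := by
      intro s hs
      have e : (2 * Λ * L s) ^ 2 * inverseConst k =
          ((2 * Λ) ^ 2 * inverseConst k) * L s ^ 2 := by ring
      rw [e, ENNReal.ofReal_mul (by positivity), ENNReal.ofReal_pow (hL0 s), hLe s hs]
      refine mul_le_mul' (ENNReal.ofReal_le_ofReal (by linarith)) (pow_le_pow_left' ?_ 2)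
      exact (le_max_right _ _).trans
        (Finset.le_sup (f := fun s => w1infNorm (interior (simplexHull s)) u) hs)
    refine ⟨hwd', T.weightedL2Sq_le hΩ fun s hs => ?_, T.weightedL2Sq_le hΩ fun s hs => ?_⟩
    -- `Λ * L s` would suffice here; the factor `2` is the one required by the second estimate and
    -- allows `hle` to serve both.
    · refine (eLpNorm_sq_le_of_forall_bound (T.isTet hs) (K := 2 * Λ * L s)
        (hv.1.mono (T.simplexHull_subset hs)) (hv.2 s hs) fun V hV => ?_).trans
          (mul_le_mul_left (hle s hs) _)
      filter_upwards [hguc s hs, ae_restrict_mem (measurableSet_simplexHull s)] with x hx hxs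
      rw [Pi.sub_apply, Pi.mul_apply, ← hx, hloc' s hs x hxs]
      refine (abs_mul_sub_localInterp_le hk (T.isTet hs) (hL0 s) (hgL s hs) (hv.2 s hs)
        hV hxs).trans ?_
      have hV0 : 0 ≤ V := (abs_nonneg _).trans (hV x hxs)
      have : 0 ≤ Λ * (L s * simplexDiam s * V) := mul_nonneg hΛ
        (mul_nonneg (mul_nonneg (hL0 s) (T.isTet hs).simplexDiam_pos.le) hV0)
      linarith
    · refine (eLpNorm_sq_le_of_forall_bound (T.isTet hs) (K := 2 * Λ * L s)
        (hv.1.mono (T.simplexHull_subset hs)) (hv.2 s hs) fun V hV => ?_).trans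
          (mul_le_mul_left (hle s hs) _)
      refine ae_restrict_of_forall_mem (measurableSet_simplexHull s) fun x hxs => ?_
      rw [Pi.sub_apply, Pi.mul_apply, hloc' s hs x hxs, hloc s hs x hxs]
      refine (abs_localInterp_mul_sub_le hk (T.isTet hs) (hL0 s) (hgL s hs) (hv.2 s hs)
        hV hxs).trans (le_of_eq (by ring))
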